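/- Consider the regular hexagonal tiling of the plane; two distinct cells are adjacent when they share an edge. A Rikudo game $(\tau,m,p)$ consists of a nonempty finite set $\tau$ of cells whose adjacency graph $G_\tau$ is connected and, with $n=|\tau|$ and $[n]=\{1,\dots,n\}$, a partial injective map $m$ from $\tau$ to $[n]$ (numbers already placed) and a set $p$ of ordered pairs of adjacent cells of $\tau$ (given adjacencies). A solution is a bijection $s:\tau\to[n]$ such that (i) any two cells $c,c'\in\tau$ with $|s(c)-s(c')|=1$ are adjacent, (ii) $s(c)=m(c)$ for every $c$ in the domain of $m$, and (iii) $|s(c)-s(c')|=1$ for every $(c,c')\in p$. The decision problem 1-over-2-Rikudo takes as input a game $(\tau,m,p)$ in which the set of values of $m$ (the numbers already placed) is exactly the set of odd numbers in $[n]$, and asks whether the game admits a solution. A game is given as a word over a fixed finite alphabet that lists the elements of $\tau$, the graph of $m$ and the elements of $p$, with cells given by integer axial coordinates and all integers written in binary. Theorem. 1-over-2-Rikudo is in $\mathsf{P}$: the language of the words that describe such a game admitting a solution is decided by a deterministic Turing machine in time polynomial in the length of the word. -/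

import Mathlib

namespace Rikudo

/-- Cells of the hexagonal grid (pointy orientation) in axial coordinates. -/
abbrev Cell := ℤ × ℤ

/-- The adjacency graph of the hexagonal grid: two cells are adjacent when they share an edge.
In axial coordinates, the six neighbours of `(a, b)` are `(a ± 1, b)`, `(a, b ± 1)`,
`(a + 1, b - 1)` and `(a - 1, b + 1)`. -/
def hexGrid : SimpleGraph Cell where
  Adj c c' :=
    (c'.1 - c.1, c'.2 - c.2) ∈
      ({(1, 0), (-1, 0), (0, 1), (0, -1), (1, -1), (-1, 1)} : Set (ℤ × ℤ))
  symm := ⟨fun c c' h => by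
    simp only [Set.mem_insert_iff, Set.mem_singleton_iff, Prod.mk.injEq] at h ⊢
    omega⟩
  loopless := ⟨fun c h => by
    simp at h⟩

/-- A Rikudo game `(τ, m, p)`. The partial map `m` is given as an `Option`-valued function that is
`none` outside `τ`; `p` is a set of ordered pairs, not necessarily symmetric. -/
structure Game where
  /-- the cells of the game -/
  τ : Finset Cell
  /-- the graph `G_τ` is connected (in particular, nonempty) -/
  connected : (hexGrid.induce (τ : Set Cell)).Connected
  /-- the numbers already placed -/
  m : Cell → Option ℕ
  m_dom : ∀ c v, m c = some v → c ∈ τ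
  m_range : ∀ c v, m c = some v → 1 ≤ v ∧ v ≤ τ.card
  m_inj : ∀ c c' v, m c = some v → m c' = some v → c = c'
  /-- the given adjacencies -/
  p : Finset (Cell × Cell)
  p_adj : ∀ c c', (c, c') ∈ p → c ∈ τ ∧ c' ∈ τ ∧ hexGrid.Adj c c'

namespace Game

/-- The number `n` of cells. -/
def n (G : Game) : ℕ := G.τ.card

/-- `s` (only its values on `τ` matter) is a solution of the game `G`. -/
structure IsSolution (G : Game) (s : Cell → ℕ) : Prop where
  bij : Set.BijOn s (G.τ : Set Cell) (Set.Icc 1 G.n)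
  path : ∀ c ∈ G.τ, ∀ c' ∈ G.τ, |(s c : ℤ) - (s c' : ℤ)| = 1 → hexGrid.Adj c c'
  placed : ∀ c v, G.m c = some v → s c = v
  given : ∀ c c', (c, c') ∈ G.p → |(s c : ℤ) - (s c' : ℤ)| = 1

/-- The game admits a solution. -/
def Solvable (G : Game) : Prop := ∃ s, G.IsSolution s

/-- The numbers already placed are exactly those of the form `x * k + 1` in `{1, …, n}`. -/
def IsOneOver (k : ℕ) (G : Game) : Prop :=
  {v | ∃ c, G.m c = some v} = {v | ∃ x : ℕ, v = x * k + 1} ∩ Set.Icc 1 G.n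

end Game

section Encoding

open Computability

/-- Binary digits of a natural number, least significant first (`0` gives the empty word). -/
def encNat (v : ℕ) : List Γ' := (encodeNat v).map Γ'.bit

/-- An integer: a sign bit, then the binary digits of the absolute value. -/
def encInt (z : ℤ) : List Γ' := Γ'.bit (decide (z < 0)) :: encNat z.natAbs

/-- A cell: its two coordinates, separated by a comma. -/
def encCell (c : Cell) : List Γ' := encInt c.1 ++ Γ'.comma :: encInt c.2

/-- A list: the concatenation of its bracketed entries. -/
def encList {α : Type} (e : α → List Γ') (l : List α) : List Γ' :=
  l.flatMap fun a => Γ'.bra :: e a ++ [Γ'.ket]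

/-- The word for a list of cells, a list of placed numbers and a list of adjacencies. -/
def encLists (cells : List Cell) (placed : List (Cell × ℕ)) (links : List (Cell × Cell)) :
    List Γ' :=
  encList encCell cells ++
    Γ'.comma :: encList (fun e => encCell e.1 ++ Γ'.comma :: encNat e.2) placed ++
    Γ'.comma :: encList (fun e => encCell e.1 ++ Γ'.comma :: encCell e.2) links

/-- The word `w` describes the game `G`: it lists `τ`, the graph of `m` and `p`, each in some
order and without repetition, all integers being written in binary. -/
def Encodes (w : List Γ') (G : Game) : Prop :=
  ∃ (cells : List Cell) (placed : List (Cell × ℕ)) (links : List (Cell × Cell)),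
    cells.Nodup ∧ placed.Nodup ∧ links.Nodup ∧
    (∀ c, c ∈ cells ↔ c ∈ G.τ) ∧
    (∀ c v, (c, v) ∈ placed ↔ G.m c = some v) ∧
    (∀ e, e ∈ links ↔ e ∈ G.p) ∧
    w = encLists cells placed links

/-- The decision problem 1-over-`k`-Rikudo, as the language of the words that describe a
1-over-`k` game admitting a solution. -/
def oneOverRikudo (k : ℕ) : Language Γ' :=
  {w | ∃ G : Game, Encodes w G ∧ G.IsOneOver k ∧ G.Solvable}

end Encoding

/-- The complexity class `P`: the language `L` is decided, on all words over `Γ`, by a Turing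
machine (with finitely many symbols on every stack) in a number of steps that is bounded by a
polynomial in the length of the word. -/
def InP {Γ : Type} (L : Language Γ) : Prop :=
  ∃ (f : List Γ → Bool)
    (M : Turing.TM2ComputableInPolyTime (id : List Γ → List Γ) Computability.encodeBool f),
    (∀ k, Finite (M.tm.Γ k)) ∧ ∀ w, f w = true ↔ w ∈ L

end Rikudo

/-!
In a 1-over-2 game every free cell receives an even number, and `2 * i + 2` has to be placed on a
common neighbour of the cells of `2 * i + 1` and `2 * i + 3`. Two distinct cells of the hexagonal
grid have at most two common neighbours, so a solution is a system of distinct representatives for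
lists of candidates that, except possibly for the last one, have at most two entries. Such a system
is found greedily: a candidate list with two entries is an edge between free cells, and
representatives exist as long as no component of the graph of these edges contains more edges than
vertices, which is decided by merging components.

For polynomial time on a Turing machine, the decision procedure is written as a functional program
on binary trees. Functions computed in polynomial time by flowcharts on trees are closed under
composition, pairing and iteration with polynomially bounded growth, and a flowchart whose trees are
serialized on four stacks is a multi-stack Turing machine.
-/

open Computability

namespace Rikudo

/-! ### Flowcharts on four stacks -/

/-- The four work stacks: trees are kept on `main`, `left` and `right` hold words that are being
moved, and `depth` counts the subtrees that a traversal has still to visit. -/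
inductive Reg
  | main | left | right | depth
  deriving DecidableEq

instance : Fintype Reg := ⟨{.main, .left, .right, .depth}, fun k => by cases k <;> simp⟩

/-- The contents of the four work stacks. -/
structure Store where
  main : List Γ'
  left : List Γ'
  right : List Γ'
  depth : List Γ'

namespace Store

def get (S : Store) : Reg → List Γ'
  | .main => S.main
  | .left => S.left
  | .right => S.right
  | .depth => S.depth

def set (S : Store) (l : List Γ') : Reg → Store
  | .main => { S with main := l }
  | .left => { S with left := l }
  | .right => { S with right := l }
  | .depth => { S with depth := l }

end Store

/-- An instruction of a flowchart, with jump targets in `X`. -/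
inductive Instr (X : Type)
  | push (k : Reg) (s : Γ') (x : X)
  | pop (k : Reg) (f : Option Γ' → X)
  | jump (x : X)

namespace Instr

def map {X Y : Type} (φ : X → Y) : Instr X → Instr Y
  | push k s x => push k s (φ x)
  | pop k f => pop k fun o => φ (f o)
  | jump x => jump (φ x)

/-- One execution step: the next jump target and the new contents of the stacks. -/
def exec {X : Type} : Instr X → Store → X × Store
  | push k s x, S => (x, S.set (s :: S.get k) k)
  | pop k f, S => (f (S.get k).head?, S.set (S.get k).tail k)
  | jump x, S => (x, S)

theorem exec_map {X Y : Type} (φ : X → Y) (i : Instr X) (S : Store) :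
    (i.map φ).exec S = (φ (i.exec S).1, (i.exec S).2) := by
  cases i <;> rfl

end Instr

/-- A flowchart with finitely many labels and with exits in `E`. Flowcharts are the building blocks
of the Turing machine; the exit through which one is left is its result. -/
structure Flowchart (E : Type) where
  Label : Type
  fintypeLabel : Fintype Label
  start : Label
  code : Label → Instr (Label ⊕ E)

namespace Flowchart

variable {E E' : Type}

/-- `F.Steps t x y`: the flowchart leads from the configuration `x` to `y` in exactly `t` steps. -/
inductive Steps (F : Flowchart E) : ℕ → (F.Label ⊕ E) × Store → (F.Label ⊕ E) × Store → Prop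
  | refl (x) : Steps F 0 x x
  | step {l S t y} : Steps F t ((F.code l).exec S) y → Steps F (t + 1) (.inl l, S) y

theorem Steps.trans {F : Flowchart E} {t t' : ℕ} {x y z} (h : F.Steps t x y)
    (h' : F.Steps t' y z) : F.Steps (t + t') x z := by
  induction h with
  | refl => simpa only [Nat.zero_add] using h'
  | step _ ih => rw [Nat.add_right_comm]; exact .step (ih h')

theorem Steps.map {F : Flowchart E} {H : Flowchart E'} (φ : F.Label ⊕ E → H.Label ⊕ E')
    (j : F.Label → H.Label) (hj : ∀ l, φ (.inl l) = .inl (j l))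
    (hc : ∀ l, H.code (j l) = (F.code l).map φ) {t : ℕ} {x y} (h : F.Steps t x y) :
    H.Steps t (φ x.1, x.2) (φ y.1, y.2) := by
  induction h with
  | refl => exact .refl _
  | step _ ih => rw [hj]; refine .step ?_; rwa [hc, Instr.exec_map]

/-- `F.Run S T e S'`: started on `S`, the flowchart is left through the exit `e` with stacks `S'`
after at most `T` steps. -/
def Run (F : Flowchart E) (S : Store) (T : ℕ) (e : E) (S' : Store) : Prop :=
  ∃ t ≤ T, F.Steps t (.inl F.start, S) (.inr e, S')

theorem Run.mono {F : Flowchart E} {S S' : Store} {T T' : ℕ} {e : E} (h : F.Run S T e S')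
    (hT : T ≤ T') : F.Run S T' e S' :=
  let ⟨t, ht, h⟩ := h; ⟨t, ht.trans hT, h⟩

/-- The flowchart with a single instruction, every target of which is an exit. -/
def single (i : Instr E) : Flowchart E where
  Label := Unit
  fintypeLabel := inferInstance
  start := ()
  code _ := i.map .inr

theorem run_single (i : Instr E) (S : Store) :
    (single i).Run S 1 (i.exec S).1 (i.exec S).2 := by
  refine ⟨1, le_rfl, .step ?_⟩
  rw [show ((single i).code (single i).start) = i.map .inr from rfl, Instr.exec_map]
  exact .refl _

def push (k : Reg) (s : Γ') : Flowchart Unit := single (.push k s ())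

def pop (k : Reg) : Flowchart (Option Γ') := single (.pop k id)

/-- The flowchart that changes nothing and is left through `e`. -/
def ret (e : E) : Flowchart E := single (.jump e)

theorem run_push (k : Reg) (s : Γ') (S : Store) :
    (push k s).Run S 1 () (S.set (s :: S.get k) k) :=
  run_single _ S

theorem run_pop (k : Reg) (S : Store) :
    (pop k).Run S 1 (S.get k).head? (S.set (S.get k).tail k) :=
  run_single _ S

theorem run_pop_cons (k : Reg) (s : Γ') (l : List Γ') (S : Store) :
    (pop k).Run (S.set (s :: l) k) 1 (some s) (S.set l k) := by
  cases k <;> exact run_pop _ _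

theorem run_ret (e : E) (S : Store) : (ret e).Run S 1 e S :=
  run_single _ S

/-- Sequential composition: the exit of `F` selects the flowchart that is run next. -/
def bind [Fintype E] (F : Flowchart E) (G : E → Flowchart E') : Flowchart E' where
  Label := F.Label ⊕ Σ e, (G e).Label
  fintypeLabel := by
    have := F.fintypeLabel
    have := fun e => (G e).fintypeLabel
    infer_instance
  start := .inl F.start
  code
    | .inl l => (F.code l).map
        (Sum.elim (fun l => .inl (.inl l)) fun e => .inl (.inr ⟨e, (G e).start⟩))
    | .inr ⟨e, l⟩ => ((G e).code l).map (Sum.elim (fun l => .inl (.inr ⟨e, l⟩)) .inr)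

theorem Run.bind [Fintype E] {F : Flowchart E} {G : E → Flowchart E'} {S S' S'' : Store}
    {T T' : ℕ} {e : E} {e' : E'} (h : F.Run S T e S') (h' : (G e).Run S' T' e' S'') :
    (F.bind G).Run S (T + T') e' S'' := by
  obtain ⟨t, ht, h⟩ := h
  obtain ⟨t', ht', h'⟩ := h'
  have h₁ := h.map (H := F.bind G)
    (Sum.elim (fun l => .inl (.inl l)) fun e => .inl (.inr ⟨e, (G e).start⟩)) .inl
    (fun _ => rfl) (fun _ => rfl)
  have h₂ := h'.map (H := F.bind G) (Sum.elim (fun l => .inl (.inr ⟨e, l⟩)) .inr)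
    (fun l => .inr ⟨e, l⟩) (fun _ => rfl) (fun _ => rfl)
  exact ⟨t + t', add_le_add ht ht', h₁.trans h₂⟩

/-- Sequential composition after a flowchart with only one exit. -/
def seq (F : Flowchart Unit) (G : Flowchart E) : Flowchart E := F.bind fun _ => G

theorem Run.seq {F : Flowchart Unit} {G : Flowchart E} {S S' S'' : Store} {T T' : ℕ} {e : E}
    (h : F.Run S T () S') (h' : G.Run S' T' e S'') : (F.seq G).Run S (T + T') e S'' :=
  Run.bind h h'

/-- Jump targets inside a loop: the exit `none` of the body leads back to its start. -/
def loopTarget {F : Flowchart (Option E)} : F.Label ⊕ Option E → F.Label ⊕ E :=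
  Sum.elim .inl fun o => o.elim (.inl F.start) .inr

/-- Repetition of `F` until it is left through an exit `some e`. -/
def loop (F : Flowchart (Option E)) : Flowchart E where
  Label := F.Label
  fintypeLabel := F.fintypeLabel
  start := F.start
  code l := (F.code l).map loopTarget

theorem Run.loop_exit {F : Flowchart (Option E)} {S S' : Store} {T : ℕ} {e : E}
    (h : F.Run S T (some e) S') : (loop F).Run S T e S' := by
  obtain ⟨t, ht, h⟩ := h
  exact ⟨t, ht, h.map (F := F) (H := F.loop) loopTarget id (fun _ => rfl) (fun _ => rfl)⟩

theorem Run.loop_next {F : Flowchart (Option E)} {S S' S'' : Store} {T T' : ℕ} {e : E}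
    (h : F.Run S T none S') (h' : (loop F).Run S' T' e S'') :
    (loop F).Run S (T + T') e S'' := by
  obtain ⟨t, ht, h⟩ := h
  obtain ⟨t', ht', h'⟩ := h'
  have h₁ := h.map (F := F) (H := F.loop) loopTarget id (fun _ => rfl) (fun _ => rfl)
  exact ⟨t + t', add_le_add ht ht', h₁.trans h'⟩

end Flowchart

/-! ### Trees on the main stack -/

/-- Binary trees, the universal data type of the flowcharts. -/
inductive Tree
  | leaf
  | node (l r : Tree)

namespace Tree

/-- The prefix code of a tree. It avoids `Γ'.comma`, which serves as the end mark of words. -/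
def word : Tree → List Γ'
  | leaf => [.bit false]
  | node l r => .bit true :: (l.word ++ r.word)

/-- The length of the prefix code, which is the number of nodes and leaves. -/
def size (v : Tree) : ℕ := v.word.length

@[simp] theorem size_node (l r : Tree) : (node l r).size = l.size + r.size + 1 := by
  simp [size, word]

theorem size_pos (v : Tree) : 0 < v.size := by
  cases v <;> simp [size, word]

theorem eq_of_word_append_eq {v w : Tree} {x y : List Γ'} (h : v.word ++ x = w.word ++ y) :
    v = w ∧ x = y := by
  induction v generalizing w x y with
  | leaf =>
    rcases w with _ | _
    · simpa [word] using h
    · simp [word] at h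
  | node l r ihl ihr =>
    rcases w with _ | ⟨l', r'⟩
    · simp [word] at h
    · simp only [word, List.cons_append, List.append_assoc, List.cons.injEq, true_and] at h
      obtain ⟨rfl, h₁⟩ := ihl h
      obtain ⟨rfl, h₂⟩ := ihr h₁
      exact ⟨rfl, h₂⟩

theorem word_injective : Function.Injective word := fun v w h =>
  (eq_of_word_append_eq (v := v) (w := w) (x := []) (y := []) (by rw [h])).1

theorem comma_notMem_word (v : Tree) : Γ'.comma ∉ v.word := by
  induction v with
  | leaf => simp [word]
  | node l r ihl ihr => simp [word, ihl, ihr]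

end Tree

namespace Flowchart

/-- Pushes `s` to the selected ones of the stacks `left` and `right`. -/
def tee (tl tr : Bool) (s : Γ') : Flowchart Unit :=
  (bif tl then push .left s else ret ()).seq (bif tr then push .right s else ret ())

/-- The stack `l` after the symbols of `w` have been pushed, if `t` selects this stack. -/
def teeList (t : Bool) (w l : List Γ') : List Γ' := bif t then w.reverse ++ l else l

theorem teeList_append (t : Bool) (w w' l : List Γ') :
    teeList t (w ++ w') l = teeList t w' (teeList t w l) := by
  cases t <;> simp [teeList]

theorem teeList_cons (t : Bool) (s : Γ') (w l : List Γ') :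
    teeList t (s :: w) l = teeList t w (teeList t [s] l) :=
  teeList_append t [s] w l

theorem run_tee (tl tr : Bool) (s : Γ') (m a b d : List Γ') :
    (tee tl tr s).Run ⟨m, a, b, d⟩ 2 () ⟨m, teeList tl [s] a, teeList tr [s] b, d⟩ := by
  cases tl <;> cases tr
  · exact Run.seq (run_ret _ _) (run_ret _ _)
  · exact Run.seq (run_ret _ _) (run_push _ _ _)
  · exact Run.seq (run_push _ _ _) (run_ret _ _)
  · exact Run.seq (run_push _ _ _) (run_push _ _ _)

/-- One step of the traversal of a tree. The stack `depth` holds one `Γ'.bra` for each subtree that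
is still to come after the current one, above the end mark `Γ'.ket`. -/
def moveStep (tl tr : Bool) : Flowchart (Option Unit) :=
  (pop .main).bind fun
    | some (.bit true) => (tee tl tr (.bit true)).seq ((push .depth .bra).seq (ret none))
    | some (.bit false) => (tee tl tr (.bit false)).seq ((pop .depth).bind fun
      | some .bra => ret none
      | _ => ret (some ()))
    | _ => ret none

theorem run_moveStep_node (tl tr : Bool) (m a b d : List Γ') :
    (moveStep tl tr).Run ⟨.bit true :: m, a, b, d⟩ 5 none
      ⟨m, teeList tl [.bit true] a, teeList tr [.bit true] b, .bra :: d⟩ :=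
  Run.mono (Run.bind (e := some (Γ'.bit true)) (run_pop _ _)
    (Run.seq (run_tee ..) (Run.seq (run_push ..) (run_ret ..)))) le_rfl

theorem run_moveStep_leaf_bra (tl tr : Bool) (m a b d : List Γ') :
    (moveStep tl tr).Run ⟨.bit false :: m, a, b, .bra :: d⟩ 5 none
      ⟨m, teeList tl [.bit false] a, teeList tr [.bit false] b, d⟩ :=
  Run.mono (Run.bind (e := some (Γ'.bit false)) (run_pop _ _)
    (Run.seq (run_tee ..) (Run.bind (e := some Γ'.bra) (run_pop ..) (run_ret ..)))) le_rfl

theorem run_moveStep_leaf_ket (tl tr : Bool) (m a b d : List Γ') :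
    (moveStep tl tr).Run ⟨.bit false :: m, a, b, .ket :: d⟩ 5 (some ())
      ⟨m, teeList tl [.bit false] a, teeList tr [.bit false] b, d⟩ :=
  Run.mono (Run.bind (e := some (Γ'.bit false)) (run_pop _ _)
    (Run.seq (run_tee ..) (Run.bind (e := some Γ'.ket) (run_pop ..) (run_ret ..)))) le_rfl

theorem run_loop_moveStep_bra (tl tr : Bool) (v : Tree) {m a b d : List Γ'} {T : ℕ} {S : Store}
    (h : (loop (moveStep tl tr)).Run ⟨m, teeList tl v.word a, teeList tr v.word b, d⟩ T () S) :
    (loop (moveStep tl tr)).Run ⟨v.word ++ m, a, b, .bra :: d⟩ (5 * v.size + T) () S := by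
  induction v generalizing m a b d T with
  | leaf => exact Run.loop_next (run_moveStep_leaf_bra ..) h
  | node l r ihl ihr =>
    rw [Tree.word, teeList_cons, teeList_append, teeList_cons tr, teeList_append] at h
    rw [Tree.word, List.cons_append, List.append_assoc]
    exact Run.mono (Run.loop_next (run_moveStep_node ..) (ihl (ihr h)))
      (by rw [Tree.size_node]; omega)

theorem run_loop_moveStep_ket (tl tr : Bool) (v : Tree) (m a b d : List Γ') :
    (loop (moveStep tl tr)).Run ⟨v.word ++ m, a, b, .ket :: d⟩ (5 * v.size) ()
      ⟨m, teeList tl v.word a, teeList tr v.word b, d⟩ := by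
  induction v generalizing m a b d with
  | leaf => exact Run.loop_exit (run_moveStep_leaf_ket ..)
  | node l r _ ihr =>
    rw [Tree.word, teeList_cons, teeList_append, teeList_cons tr, teeList_append,
      List.cons_append, List.append_assoc]
    exact Run.mono (Run.loop_next (run_moveStep_node ..)
      (run_loop_moveStep_bra tl tr l (ihr ..))) (by rw [Tree.size_node]; omega)

/-- Removal of the tree on top of the main stack. Its word is moved, reversed and with an end mark,
to the selected ones of the stacks `left` and `right`. -/
def move (tl tr : Bool) : Flowchart Unit :=
  (tee tl tr .comma).seq ((push .depth .ket).seq (loop (moveStep tl tr)))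

theorem run_move (tl tr : Bool) (v : Tree) (m a b d : List Γ') :
    (move tl tr).Run ⟨v.word ++ m, a, b, d⟩ (5 * v.size + 3) ()
      ⟨m, teeList tl (.comma :: v.word) a, teeList tr (.comma :: v.word) b, d⟩ := by
  rw [teeList_cons tl, teeList_cons tr]
  exact Run.mono (Run.seq (run_tee ..) (Run.seq (run_push ..) (run_loop_moveStep_ket ..)))
    (by omega)

/-- The inverse of `move`: the word on the stack `k` is moved back, up to its end mark. -/
def moveBack (k : Reg) : Flowchart Unit :=
  loop ((pop k).bind fun
    | some .comma => ret (some ())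
    | some s => (push .main s).seq (ret none)
    | none => ret (some ()))

theorem run_moveBack {k : Reg} (hk : k ≠ .main) {w : List Γ'} (hw : Γ'.comma ∉ w) (S : Store) :
    (moveBack k).Run (S.set (w ++ .comma :: S.get k) k) (3 * w.length + 2) ()
      (S.set (w.reverse ++ S.main) .main) := by
  induction w generalizing S with
  | nil =>
    have hS : S.set (S.get k) k = S.set S.main .main := by cases k <;> rfl
    rw [List.reverse_nil, List.nil_append, List.nil_append, ← hS]
    exact Run.mono (Run.loop_exit (Run.bind (e := some Γ'.comma) (run_pop_cons ..) (run_ret ..)))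
      le_rfl
  | cons s w ih =>
    obtain ⟨hs, hw⟩ := List.ne_and_not_mem_of_not_mem_cons hw
    have hpush : (push .main s).Run (S.set (w ++ .comma :: S.get k) k) 1 ()
        ((S.set (s :: S.main) .main).set
          (w ++ .comma :: (S.set (s :: S.main) .main).get k) k) := by
      cases k <;> first | exact (hk rfl).elim | exact run_push ..
    have h := ih hw (S.set (s :: S.main) .main)
    rw [List.reverse_cons, List.append_assoc, List.length_cons]
    refine Run.mono (Run.loop_next (Run.bind (e := some s) (run_pop_cons ..) (T' := 2) ?_) h)
      (by omega)
    rcases s with _ | _ | _ | _ | _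
    any_goals exact Run.seq hpush (run_ret ..)
    exact absurd rfl hs

theorem run_moveBack_tree {k : Reg} (hk : k ≠ .main) (v : Tree) (S : Store) :
    (moveBack k).Run (S.set (teeList true (.comma :: v.word) (S.get k)) k) (3 * v.size + 2) ()
      (S.set (v.word ++ S.main) .main) := by
  have h := run_moveBack hk (by simpa using v.comma_notMem_word : Γ'.comma ∉ v.word.reverse) S
  simpa [teeList, Tree.size] using h

def drop : Flowchart Unit := move false false

theorem run_drop (v : Tree) (m a b d : List Γ') :
    drop.Run ⟨v.word ++ m, a, b, d⟩ (5 * v.size + 3) () ⟨m, a, b, d⟩ :=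
  run_move false false v m a b d

/-- Duplicates the tree on top of the main stack. -/
def dup : Flowchart Unit := (move true true).seq ((moveBack .left).seq (moveBack .right))

theorem run_dup (v : Tree) (m a b d : List Γ') :
    dup.Run ⟨v.word ++ m, a, b, d⟩ (11 * v.size + 7) () ⟨v.word ++ (v.word ++ m), a, b, d⟩ :=
  Run.mono (Run.seq (run_move ..)
    (Run.seq (run_moveBack_tree (k := .left) nofun v ⟨m, a, _, d⟩)
      (run_moveBack_tree (k := .right) nofun v ⟨v.word ++ m, a, b, d⟩))) (by omega)

/-- Exchanges the two trees on top of the main stack. -/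
def swap : Flowchart Unit :=
  (move true false).seq ((move false true).seq ((moveBack .left).seq (moveBack .right)))

theorem run_swap (v w : Tree) (m a b d : List Γ') :
    swap.Run ⟨v.word ++ (w.word ++ m), a, b, d⟩ (8 * v.size + 8 * w.size + 10) ()
      ⟨w.word ++ (v.word ++ m), a, b, d⟩ :=
  Run.mono (Run.seq (run_move true false v ..) (Run.seq (run_move false true w ..)
    (Run.seq (run_moveBack_tree (k := .left) nofun v ⟨m, a, _, d⟩)
      (run_moveBack_tree (k := .right) nofun w ⟨v.word ++ m, a, b, d⟩)))) (by omega)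

def pushWord : List Γ' → Flowchart Unit
  | [] => ret ()
  | s :: w => (pushWord w).seq (push .main s)

theorem run_pushWord (w m a b d : List Γ') :
    (pushWord w).Run ⟨m, a, b, d⟩ (w.length + 1) () ⟨w ++ m, a, b, d⟩ := by
  induction w with
  | nil => exact run_ret _ _
  | cons s w ih => exact Run.mono (Run.seq ih (run_push ..)) (by simp)

/-- Empties the stack `k` up to and including the next end mark. -/
def drain (k : Reg) : Flowchart Unit :=
  loop ((pop k).bind fun
    | some .comma => ret (some ())
    | some _ => ret none
    | none => ret (some ()))

theorem run_drain (k : Reg) {w : List Γ'} (hw : Γ'.comma ∉ w) (l : List Γ') (S : Store) :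
    (drain k).Run (S.set (w ++ .comma :: l) k) (2 * w.length + 2) () (S.set l k) := by
  induction w with
  | nil =>
    exact Run.mono (Run.loop_exit (Run.bind (e := some Γ'.comma) (run_pop_cons ..) (run_ret ..)))
      le_rfl
  | cons s w ih =>
    obtain ⟨hs, hw⟩ := List.ne_and_not_mem_of_not_mem_cons hw
    rw [List.length_cons]
    refine Run.mono (Run.loop_next (Run.bind (e := some s) (run_pop_cons ..) (T' := 1) ?_)
      (ih hw)) (by omega)
    rcases s with _ | _ | _ | _ | _
    any_goals exact run_ret ..
    exact absurd rfl hs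

/-- Removal of the rest of a word whose first symbol `x`, possibly the end mark, has been popped. -/
def drainFrom (k : Reg) (x : Option Γ') : Flowchart Unit :=
  if x = some .comma then ret () else drain k

theorem run_drainFrom (k : Reg) {w : List Γ'} (hw : Γ'.comma ∉ w) {s : Γ'} {l l' : List Γ'}
    (h : w ++ .comma :: l = s :: l') (S : Store) :
    (drainFrom k (some s)).Run (S.set l' k) (2 * w.length + 2) () (S.set l k) := by
  rcases w with _ | ⟨s', w⟩ <;> obtain ⟨rfl, rfl⟩ := List.cons_eq_cons.1 h
  · exact (run_ret _ _).mono (by omega)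
  · obtain ⟨hs, hw⟩ := List.ne_and_not_mem_of_not_mem_cons hw
    rw [drainFrom, if_neg (by simpa using hs.symm)]
    exact (run_drain k hw l S).mono (by simp)

/-- Removes the topmost words of `left` and `right`, with their end marks, and tells whether they
are equal. -/
def compare : Flowchart Bool :=
  loop ((pop .left).bind fun x => (pop .right).bind fun y =>
    if x = y then if x = some .comma then ret (some true) else ret none
    else (drainFrom .left x).seq ((drainFrom .right y).seq (ret (some false))))

theorem run_compare_of_head_ne {w w' : List Γ'} (hw : Γ'.comma ∉ w) (hw' : Γ'.comma ∉ w')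
    {m a a' b b' d : List Γ'} {s s' : Γ'} (h : w ++ .comma :: a = s :: a')
    (h' : w' ++ .comma :: b = s' :: b') (hs : s ≠ s') :
    compare.Run ⟨m, w ++ .comma :: a, w' ++ .comma :: b, d⟩
      (3 * w.length + 3 * w'.length + 7) false ⟨m, a, b, d⟩ := by
  rw [h, h']
  refine Run.mono (Run.loop_exit (Run.bind (e := some s) (run_pop ..)
    (Run.bind (e := some s') (run_pop ..)
      (T' := 2 * w.length + 2 + (2 * w'.length + 2 + 1)) ?_))) (by omega)
  rw [if_neg (by simpa using hs)]
  exact Run.seq (run_drainFrom .left hw h ⟨m, a', b', d⟩)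
    (Run.seq (run_drainFrom .right hw' h' ⟨m, a, b', d⟩) (run_ret ..))

theorem run_compare {w w' : List Γ'} (hw : Γ'.comma ∉ w) (hw' : Γ'.comma ∉ w')
    (m a b d : List Γ') : compare.Run ⟨m, w ++ .comma :: a, w' ++ .comma :: b, d⟩
      (3 * w.length + 3 * w'.length + 7) (decide (w = w')) ⟨m, a, b, d⟩ := by
  induction w generalizing w' with
  | nil =>
    rcases w' with _ | ⟨s', w'⟩
    · exact Run.mono (Run.loop_exit (Run.bind (e := some Γ'.comma) (run_pop ..)
        (Run.bind (e := some Γ'.comma) (run_pop ..) (run_ret (some true) _)))) (by omega)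
    · exact run_compare_of_head_ne hw hw' rfl rfl (List.ne_of_not_mem_cons hw')
  | cons s w ih =>
    rcases w' with _ | ⟨s', w'⟩
    · exact run_compare_of_head_ne hw hw' rfl rfl (List.ne_of_not_mem_cons hw).symm
    by_cases hs : s = s'
    · subst hs
      obtain ⟨hs, hw⟩ := List.ne_and_not_mem_of_not_mem_cons hw
      rw [show decide (s :: w = s :: w') = decide (w = w') by simp]
      refine Run.mono (Run.loop_next (Run.bind (e := some s) (run_pop ..)
        (Run.bind (e := some s) (run_pop ..) (T' := 1) ?_))
        (ih hw (List.not_mem_of_not_mem_cons hw'))) (by simp only [List.length_cons]; omega)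
      rw [if_pos rfl, if_neg (by simpa using hs.symm)]
      exact run_ret _ _
    · rw [decide_eq_false fun h => hs (List.cons_eq_cons.1 h).1]
      exact run_compare_of_head_ne hw hw' rfl rfl hs

/-- Removes the two trees on top of the main stack and tells whether they are equal. -/
def treeEq : Flowchart Bool := (move true false).seq ((move false true).seq compare)

open scoped Classical in
theorem run_treeEq (v w : Tree) (m a b d : List Γ') :
    treeEq.Run ⟨v.word ++ (w.word ++ m), a, b, d⟩ (8 * v.size + 8 * w.size + 13)
      (decide (v = w)) ⟨m, a, b, d⟩ := by
  have hc : compare.Run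
      ⟨m, teeList true (.comma :: v.word) a, teeList true (.comma :: w.word) b, d⟩
      (3 * v.size + 3 * w.size + 7) (decide (v = w)) ⟨m, a, b, d⟩ := by
    have h := run_compare (w := v.word.reverse) (w' := w.word.reverse)
      (by simpa using v.comma_notMem_word) (by simpa using w.comma_notMem_word) m a b d
    simpa [teeList, Tree.size, Tree.word_injective.eq_iff] using h
  exact Run.mono (Run.seq (run_move true false v ..) (Run.seq (run_move false true w ..) hc))
    (by omega)

end Flowchart

/-! ### Functions computable in polynomial time -/

/-- Types whose elements are coded by trees, so that flowcharts can operate on them. -/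
class TreeEncodable (α : Type) where
  encode : α → Tree
  encode_injective : Function.Injective encode

open TreeEncodable (encode encode_injective)

/-- The size of the code of an element, in terms of which running times are measured. -/
def codeSize {α : Type} [TreeEncodable α] (a : α) : ℕ := (encode a).size

section Encodings

variable {α β : Type} [TreeEncodable α] [TreeEncodable β]

theorem codeSize_pos (a : α) : 0 < codeSize a := Tree.size_pos _

instance : TreeEncodable Bool where
  encode b := bif b then .node .leaf .leaf else .leaf
  encode_injective := by rintro (_ | _) (_ | _) <;> simp

instance : TreeEncodable (α × β) where
  encode p := .node (encode p.1) (encode p.2)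
  encode_injective p q h := by
    simp only [Tree.node.injEq] at h
    exact Prod.ext (encode_injective h.1) (encode_injective h.2)

/-- The code of a list: a right comb that carries the codes of the entries. -/
def encodeList : List α → Tree
  | [] => .leaf
  | a :: l => .node (encode a) (encodeList l)

instance : TreeEncodable (List α) where
  encode := encodeList
  encode_injective l := by
    induction l with
    | nil => rintro (_ | _) h <;> simp [encodeList] at h ⊢
    | cons a l ih =>
      rintro (_ | ⟨b, l'⟩) h
      · simp [encodeList] at h
      · simp only [encodeList, Tree.node.injEq] at h
        rw [encode_injective h.1, ih h.2]

theorem word_encode_pair_append (a : α) (b : β) (m : List Γ') : (encode (a, b)).word ++ m =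
    .bit true :: ((encode a).word ++ ((encode b).word ++ m)) := by
  simp [encode, Tree.word]

theorem word_encode_cons_append (a : α) (l : List α) (m : List Γ') : (encode (a :: l)).word ++ m =
    .bit true :: ((encode a).word ++ ((encode l).word ++ m)) := by
  simp [encode, Tree.word, encodeList]

theorem codeSize_bool_le (b : Bool) : codeSize b ≤ 3 := by cases b <;> decide

theorem codeSize_pair (a : α) (b : β) : codeSize (a, b) = codeSize a + codeSize b + 1 :=
  Tree.size_node _ _

theorem codeSize_nil : codeSize ([] : List α) = 1 := rfl

theorem codeSize_cons (a : α) (l : List α) : codeSize (a :: l) = codeSize a + codeSize l + 1 :=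
  Tree.size_node _ _

theorem length_lt_codeSize (l : List α) : l.length < codeSize l := by
  induction l with
  | nil => simp [codeSize_nil]
  | cons a l ih => rw [codeSize_cons, List.length_cons]; omega

theorem codeSize_append (l l' : List α) :
    codeSize (l ++ l') + 1 = codeSize l + codeSize l' := by
  induction l with
  | nil => rw [List.nil_append, codeSize_nil, add_comm]
  | cons a l ih => rw [List.cons_append, codeSize_cons, codeSize_cons]; omega

theorem codeSize_le_of_mem {a : α} {l : List α} (h : a ∈ l) : codeSize a ≤ codeSize l := by
  obtain ⟨l₁, l₂, rfl⟩ := List.append_of_mem h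
  have h₁ := codeSize_append l₁ (a :: l₂)
  have h₂ := codeSize_pos l₁
  rw [codeSize_cons] at h₁
  omega

end Encodings

section

variable {α β γ σ : Type} [TreeEncodable α] [TreeEncodable β] [TreeEncodable γ] [TreeEncodable σ]

theorem monotone_eval (p : Polynomial ℕ) : Monotone fun x => p.eval x := fun x y h => by
  simp only [Polynomial.eval_eq_sum]
  exact Finset.sum_le_sum fun i _ => Nat.mul_le_mul_left _ (Nat.pow_le_pow_left h i)

/-- The quantity `c a` is bounded by a polynomial in the size of the code of `a`. -/
def PolyBounded (c : α → ℕ) : Prop := ∃ p : Polynomial ℕ, ∀ a, c a ≤ p.eval (codeSize a)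

namespace PolyBounded

open Polynomial

variable {c d : α → ℕ}

theorem mono (hd : PolyBounded d) (h : ∀ a, c a ≤ d a) : PolyBounded c :=
  let ⟨p, hp⟩ := hd; ⟨p, fun a => (h a).trans (hp a)⟩

protected theorem codeSize : PolyBounded fun a : α => codeSize a := ⟨X, fun a => by simp⟩

theorem const (k : ℕ) : PolyBounded fun _ : α => k := ⟨C k, fun a => by simp⟩

theorem add (hc : PolyBounded c) (hd : PolyBounded d) : PolyBounded fun a => c a + d a :=
  let ⟨p, hp⟩ := hc
  let ⟨q, hq⟩ := hd
  ⟨p + q, fun a => by rw [eval_add]; exact add_le_add (hp a) (hq a)⟩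

theorem mul (hc : PolyBounded c) (hd : PolyBounded d) : PolyBounded fun a => c a * d a :=
  let ⟨p, hp⟩ := hc
  let ⟨q, hq⟩ := hd
  ⟨p * q, fun a => by rw [eval_mul]; exact Nat.mul_le_mul (hp a) (hq a)⟩

theorem linear (k n : ℕ) : PolyBounded fun a : α => k * codeSize a + n :=
  ((const k).mul .codeSize).add (const n)

theorem eval (hc : PolyBounded c) (p : ℕ[X]) : PolyBounded fun a => p.eval (c a) :=
  let ⟨q, hq⟩ := hc
  ⟨p.comp q, fun a => by rw [eval_comp]; exact monotone_eval p (hq a)⟩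

theorem comp {c : β → ℕ} {f : α → β} (hc : PolyBounded c)
    (hf : PolyBounded fun a => codeSize (f a)) : PolyBounded fun a => c (f a) :=
  let ⟨p, hp⟩ := hc
  (hf.eval p).mono fun a => hp (f a)

end PolyBounded

/-- The flowchart `F` replaces the code of `a` on top of the main stack by the code of `f a`, within
`T a` steps and leaving everything else on the stacks untouched. -/
def Flowchart.Computes (F : Flowchart Unit) (f : α → β) (T : α → ℕ) : Prop :=
  ∀ a m x y z, F.Run ⟨(encode a).word ++ m, x, y, z⟩ (T a) () ⟨(encode (f a)).word ++ m, x, y, z⟩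

/-- The function `f` has values of polynomial size and is computed by some flowchart in polynomial
time. -/
def PolyTime (f : α → β) : Prop :=
  (PolyBounded fun a => codeSize (f a)) ∧
    ∃ (F : Flowchart Unit) (T : α → ℕ), PolyBounded T ∧ F.Computes f T

namespace PolyTime

open Flowchart Polynomial

theorem of_encode_eq {f : α → β} (h : ∀ a, encode (f a) = encode a) : PolyTime f := by
  refine ⟨PolyBounded.codeSize.mono fun a => ?_, ret (), fun _ => 1, .const 1,
    fun a m x y z => ?_⟩
  · rw [codeSize, codeSize, h]
  · rw [h]
    exact run_ret ..

protected theorem id : PolyTime (fun a : α => a) := of_encode_eq fun _ => rfl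

theorem comp {g : β → γ} {f : α → β} (hg : PolyTime g) (hf : PolyTime f) :
    PolyTime fun a => g (f a) := by
  obtain ⟨hgs, G, U, hU, hG⟩ := hg
  obtain ⟨hfs, F, T, hT, hF⟩ := hf
  exact ⟨hgs.comp hfs, F.seq G, fun a => T a + U (f a), hT.add (hU.comp hfs),
    fun a m x y z => Run.seq (hF ..) (hG ..)⟩

theorem const (b : β) : PolyTime fun _ : α => b := by
  refine ⟨.const _, drop.seq (pushWord (encode b).word),
    fun a => 5 * codeSize a + 3 + (codeSize b + 1), ?_,
    fun a m x y z => Run.seq (run_drop ..) (run_pushWord ..)⟩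
  apply_rules [PolyBounded.codeSize, PolyBounded.const, PolyBounded.add, PolyBounded.mul]

theorem pair {f : α → β} {g : α → γ} (hf : PolyTime f) (hg : PolyTime g) :
    PolyTime fun a => (f a, g a) := by
  obtain ⟨hfs, F, T, hT, hF⟩ := hf
  obtain ⟨hgs, G, U, hU, hG⟩ := hg
  refine ⟨((hfs.add hgs).add (.const 1)).mono fun a => (codeSize_pair _ _).le,
    dup.seq (G.seq (swap.seq (F.seq (push .main (.bit true))))),
    fun a => 11 * codeSize a + 7 +
      (U a + (8 * codeSize (g a) + 8 * codeSize a + 10 + (T a + 1))), ?_, fun a m x y z => ?_⟩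
  · apply_rules [PolyBounded.codeSize, PolyBounded.const, PolyBounded.add, PolyBounded.mul]
  · rw [word_encode_pair_append]
    exact Run.seq (run_dup ..) (Run.seq (hG ..)
      (Run.seq (run_swap (encode (g a)) (encode a) ..) (Run.seq (hF ..) (run_push ..))))

theorem fst : PolyTime (Prod.fst : α × β → α) := by
  refine ⟨PolyBounded.codeSize.mono fun a => ?_, (pop .main).bind fun _ => swap.seq drop,
    fun a => 13 * codeSize a + 14, .linear _ _, fun ⟨a, b⟩ m x y z => ?_⟩
  · have : codeSize a = codeSize a.1 + codeSize a.2 + 1 := codeSize_pair ..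
    omega
  · rw [word_encode_pair_append]
    refine Run.mono (Run.bind (e := some (Γ'.bit true)) (run_pop ..)
      (Run.seq (run_swap (encode a) (encode b) ..) (run_drop (encode b) ..))) ?_
    have h := codeSize_pair a b
    simp only [codeSize] at h ⊢
    omega

theorem snd : PolyTime (Prod.snd : α × β → β) := by
  refine ⟨PolyBounded.codeSize.mono fun a => ?_, (pop .main).bind fun _ => drop,
    fun a => 5 * codeSize a + 4, .linear _ _, fun ⟨a, b⟩ m x y z => ?_⟩
  · have : codeSize a = codeSize a.1 + codeSize a.2 + 1 := codeSize_pair ..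
    omega
  · rw [word_encode_pair_append]
    refine Run.mono (Run.bind (e := some (Γ'.bit true)) (run_pop ..) (run_drop (encode a) ..)) ?_
    have h := codeSize_pair a b
    simp only [codeSize] at h ⊢
    omega

theorem tail : PolyTime (List.tail : List α → List α) := by
  refine ⟨PolyBounded.codeSize.mono fun l => ?_, (pop .main).bind fun
    | some (.bit true) => drop
    | _ => push .main (.bit false), fun l => 5 * codeSize l + 4, .linear _ _, fun l m x y z => ?_⟩
  · rcases l with _ | ⟨a, l⟩
    · exact le_rfl
    · rw [codeSize_cons, List.tail_cons]; omega
  · rcases l with _ | ⟨a, l⟩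
    · exact Run.mono (Run.bind (e := some (Γ'.bit false)) (run_pop ..) (run_push ..))
        (Nat.le_add_left _ _)
    · rw [word_encode_cons_append]
      refine Run.mono (Run.bind (e := some (Γ'.bit true)) (run_pop ..)
        (run_drop (encode a) ..)) ?_
      have h := codeSize_cons a l
      simp only [codeSize] at h ⊢
      omega

theorem headD (d : α) : PolyTime fun l : List α => l.headD d := by
  refine ⟨(PolyBounded.codeSize.add (.const (codeSize d))).mono fun l => ?_, (pop .main).bind fun
    | some (.bit true) => swap.seq drop
    | _ => pushWord (encode d).word, fun l => 13 * codeSize l + (14 + codeSize d),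
    .linear _ _,
    fun l m x y z => ?_⟩
  · rcases l with _ | ⟨a, l⟩
    · exact Nat.le_add_left _ _
    · simp only [List.headD_cons, codeSize_cons]; omega
  · rcases l with _ | ⟨a, l⟩
    · refine Run.mono (Run.bind (e := some (Γ'.bit false)) (run_pop ..) (run_pushWord ..)) ?_
      simp only [codeSize, Tree.size]
      omega
    · rw [word_encode_cons_append]
      refine Run.mono (Run.bind (e := some (Γ'.bit true)) (run_pop ..)
        (Run.seq (run_swap (encode a) (encode l) ..) (run_drop (encode l) ..))) ?_
      have h := codeSize_cons a l
      simp only [codeSize] at h ⊢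
      omega

theorem cond {c : α → Bool} {f g : α → β} (hc : PolyTime c) (hf : PolyTime f) (hg : PolyTime g) :
    PolyTime fun a => bif c a then f a else g a := by
  obtain ⟨-, K, R, hR, hK⟩ := hc
  obtain ⟨hfs, F, T, hT, hF⟩ := hf
  obtain ⟨hgs, G, U, hU, hG⟩ := hg
  refine ⟨(hfs.add hgs).mono fun a => ?_, dup.seq (K.seq ((pop .main).bind fun
    | some (.bit true) => (pop .main).bind fun _ => (pop .main).bind fun _ => F
    | _ => G)), fun a => 11 * codeSize a + 7 + (R a + (3 + (T a + U a))), ?_, fun a m x y z => ?_⟩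
  · simp only
    cases c a
    · exact Nat.le_add_left _ _
    · exact Nat.le_add_right _ _
  · apply_rules [PolyBounded.codeSize, PolyBounded.const, PolyBounded.add, PolyBounded.mul]
  · refine Run.seq (run_dup (encode a) ..) (Run.seq (hK ..) ?_)
    simp only
    cases c a
    · exact Run.mono (Run.bind (e := some (Γ'.bit false)) (run_pop ..) (hG a m x y z)) (by omega)
    · exact Run.mono (Run.bind (e := some (Γ'.bit true)) (run_pop ..)
        (Run.bind (e := some (Γ'.bit false)) (run_pop ..)
          (Run.bind (e := some (Γ'.bit false)) (run_pop ..) (hF a m x y z)))) (by omega)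

theorem decide_eq_pair [DecidableEq α] : PolyTime fun p : α × α => decide (p.1 = p.2) := by
  classical
  refine ⟨(PolyBounded.const 3).mono fun _ => codeSize_bool_le _,
    (pop .main).bind fun _ => treeEq.bind fun b => pushWord (encode b).word,
    fun p => 8 * codeSize p + 18, .linear _ _, fun ⟨a, b⟩ m x y z => ?_⟩
  · have h := run_treeEq (encode a) (encode b) m x y z
    rw [show decide (encode a = encode b) = decide (a = b) by
      simp [encode_injective.eq_iff]] at h
    rw [word_encode_pair_append]
    refine Run.mono (Run.bind (e := some (Γ'.bit true)) (run_pop ..)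
      (Run.bind h (run_pushWord ..))) ?_
    have hb := codeSize_bool_le (decide (a = b))
    have h := codeSize_pair a b
    simp only [codeSize, Tree.size] at h hb ⊢
    omega

theorem decide_eq [DecidableEq β] {f g : α → β} (hf : PolyTime f) (hg : PolyTime g) :
    PolyTime fun a => decide (f a = g a) :=
  decide_eq_pair.comp (hf.pair hg)

/-- The loop that runs a flowchart as long as the list in the first component is not empty. -/
def whileCons (B : Flowchart Unit) : Flowchart Unit :=
  loop ((pop .main).bind fun _ => (pop .main).bind fun
    | some (.bit true) => (pushWord [.bit true, .bit true]).seq (B.seq (ret none))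
    | _ => (pushWord [.bit true, .bit false]).seq (ret (some ())))

theorem run_whileCons {f : σ → β → α → β} {B : Flowchart Unit}
    {T : (α × List α) × σ × β → ℕ}
    (hB : B.Computes (fun q => (q.1.2, q.2.1, f q.2.1 q.2.2 q.1.1)) T) (s : σ) {N : ℕ}
    (m x y z : List Γ') (l : List α) : ∀ b : β,
    (∀ l₁ a l₂, l = l₁ ++ a :: l₂ → T ((a, l₂), s, l₁.foldl (f s) b) ≤ N) →
    (whileCons B).Run ⟨(encode (l, s, b)).word ++ m, x, y, z⟩ (l.length * (N + 6) + 6) ()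
      ⟨(encode (([] : List α), s, l.foldl (f s) b)).word ++ m, x, y, z⟩ := by
  induction l with
  | nil =>
    intro b _
    exact Run.mono (Run.loop_exit (Run.bind (e := some (Γ'.bit true)) (run_pop ..)
      (Run.bind (e := some (Γ'.bit false)) (run_pop ..)
        (Run.seq (run_pushWord ..) (run_ret ..))))) (by simp)
  | cons a l ih =>
    intro b hT
    have hrest := ih (f s b a) fun l₁ a' l₂ h => hT (a :: l₁) a' l₂ (by rw [h]; rfl)
    have hbody := (hB ((a, l), s, b) m x y z).mono (hT [] a l rfl)
    refine Run.mono (Run.loop_next (Run.bind (e := some (Γ'.bit true)) (run_pop ..)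
      (Run.bind (e := some (Γ'.bit true)) (run_pop ..)
        (Run.seq (run_pushWord ..) (Run.seq hbody (run_ret ..))))) hrest) ?_
    simp only [List.length_cons, List.length_nil, add_mul]
    omega

theorem foldl {l : σ → List α} {i : σ → β} {f : σ × β × α → β} {N : σ → ℕ} (hl : PolyTime l)
    (hi : PolyTime i) (hf : PolyTime f) (hN : PolyBounded N)
    (h : ∀ s l', l' <+: l s → codeSize (l'.foldl (fun b a => f (s, b, a)) (i s)) ≤ N s) :
    PolyTime fun s => (l s).foldl (fun b a => f (s, b, a)) (i s) := by
  obtain ⟨-, B, T, ⟨p, hp⟩, hB⟩ :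
      PolyTime fun q : (α × List α) × σ × β => (q.1.2, q.2.1, f (q.2.1, q.2.2, q.1.1)) :=
    (snd.comp fst).pair ((fst.comp snd).pair (hf.comp ((fst.comp snd).pair
      ((snd.comp snd).pair (fst.comp fst)))))
  obtain ⟨-, I, U, hU, hI⟩ := hl.pair (PolyTime.id.pair hi)
  let M s := p.eval (codeSize (l s) + (codeSize s + (N s + 2)))
  have hM : PolyBounded M := (hl.1.add (.add .codeSize (hN.add (.const 2)))).eval p
  have hT s (l₁ : List α) a l₂ (hs : l s = l₁ ++ a :: l₂) :
      T ((a, l₂), s, l₁.foldl (fun b a => f (s, b, a)) (i s)) ≤ M s := by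
    refine (hp _).trans (monotone_eval p ?_)
    have h₁ := h s l₁ ⟨_, hs.symm⟩
    have h₂ := codeSize_append l₁ (a :: l₂)
    have h₃ := codeSize_pos l₁
    rw [codeSize_cons, ← hs] at h₂
    rw [codeSize_pair, codeSize_pair, codeSize_pair]
    omega
  have hW : PolyTime fun s => (([] : List α), s, (l s).foldl (fun b a => f (s, b, a)) (i s)) := by
    refine ⟨(PolyBounded.codeSize.add (hN.add (.const 3))).mono fun s => ?_, I.seq (whileCons B),
      fun s => U s + (codeSize (l s) * (M s + 6) + 6),
      hU.add ((hl.1.mul (hM.add (.const 6))).add (.const 6)), fun s m x y z => ?_⟩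
    · have := h s (l s) List.prefix_rfl
      rw [codeSize_pair, codeSize_pair, codeSize_nil]
      omega
    · have hloop := run_whileCons (f := fun s b a => f (s, b, a)) hB s m x y z (l s) (i s) (hT s)
      exact Run.seq (hI s ..) (hloop.mono
        (Nat.add_le_add_right (Nat.mul_le_mul_right _ (length_lt_codeSize _).le) _))
  exact (snd.comp snd).comp hW

theorem foldl_of_growth {l : σ → List α} {i : σ → β} {f : σ × β × α → β} {d : σ → ℕ}
    (hl : PolyTime l) (hi : PolyTime i) (hf : PolyTime f) (hd : PolyBounded d)
    (h : ∀ s b, ∀ a ∈ l s, codeSize (f (s, b, a)) ≤ codeSize b + d s) :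
    PolyTime fun s => (l s).foldl (fun b a => f (s, b, a)) (i s) := by
  refine foldl hl hi hf (hi.1.add (hl.1.mul hd)) fun s l' hl' => ?_
  have growth : ∀ l'' ⊆ l s, ∀ b,
      codeSize (l''.foldl (fun b a => f (s, b, a)) b) ≤ codeSize b + l''.length * d s := by
    intro l''
    induction l'' with
    | nil => simp
    | cons a l'' ih =>
      intro hsub b
      have h₁ := h s b a (hsub List.mem_cons_self)
      have h₂ := ih (List.subset_of_cons_subset hsub) (f (s, b, a))
      simp only [List.foldl_cons, List.length_cons, add_mul]
      omega
  refine (growth l' hl'.subset (i s)).trans (Nat.add_le_add_left (Nat.mul_le_mul_right _ ?_) _)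
  exact hl'.length_le.trans (length_lt_codeSize _).le

theorem exists_polyBounded_codeSize_le {l : σ → List α} {f : σ × α → β} (hl : PolyTime l)
    (hf : PolyTime f) : ∃ d : σ → ℕ, PolyBounded d ∧ ∀ s, ∀ a ∈ l s, codeSize (f (s, a)) ≤ d s := by
  obtain ⟨p, hp⟩ := hf.1
  refine ⟨_, (PolyBounded.codeSize.add (hl.1.add (.const 1))).eval p,
    fun s a ha => (hp (s, a)).trans (monotone_eval p ?_)⟩
  have := codeSize_le_of_mem ha
  rw [codeSize_pair]
  omega

theorem cons {f : σ → α} {g : σ → List α} (hf : PolyTime f) (hg : PolyTime g) :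
    PolyTime fun s => f s :: g s :=
  (of_encode_eq (f := fun p : α × List α => p.1 :: p.2) fun _ => rfl).comp (hf.pair hg)

theorem reverseAux {f g : σ → List α} (hf : PolyTime f) (hg : PolyTime g) :
    PolyTime fun s => (f s).reverse ++ g s := by
  have h := foldl_of_growth (f := fun q => q.2.2 :: q.2.1) hf hg
    ((snd.comp snd).cons (fst.comp snd)) (hf.1.add (.const 1)) fun s b a ha => ?_
  · simpa using h
  · have := codeSize_le_of_mem ha
    simp only [codeSize_cons]
    omega

theorem reverse {f : σ → List α} (hf : PolyTime f) : PolyTime fun s => (f s).reverse := by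
  simpa using hf.reverseAux (const [])

theorem append {f g : σ → List α} (hf : PolyTime f) (hg : PolyTime g) :
    PolyTime fun s => f s ++ g s := by
  simpa using hf.reverse.reverseAux hg

theorem map {l : σ → List α} {f : σ × α → β} (hl : PolyTime l)
    (hf : PolyTime f) : PolyTime fun s => (l s).map fun a => f (s, a) := by
  obtain ⟨d, hd, hfd⟩ := exists_polyBounded_codeSize_le hl hf
  have h := foldl_of_growth (f := fun q => f (q.1, q.2.2) :: q.2.1) hl (const ([] : List β))
    ((hf.comp (fst.pair (snd.comp snd))).cons (fst.comp snd)) (hd.add (.const 1))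
    fun s b a ha => ?_
  · simpa using h.reverse
  · have := hfd s a ha
    simp only [codeSize_cons]
    omega

theorem filter {l : σ → List α} {f : σ × α → Bool} (hl : PolyTime l)
    (hf : PolyTime f) : PolyTime fun s => (l s).filter fun a => f (s, a) := by
  have h := foldl_of_growth (f := fun q => bif f (q.1, q.2.2) then q.2.2 :: q.2.1 else q.2.1) hl
    (const ([] : List α)) ((hf.comp (fst.pair (snd.comp snd))).cond
      ((snd.comp snd).cons (fst.comp snd)) (fst.comp snd)) (hl.1.add (.const 1)) fun s b a ha => ?_
  · convert h.reverse using 2 with s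
    have key : ∀ l b : List α, l.foldl (fun l a => bif f (s, a) then a :: l else l) b =
        (l.filter fun a => f (s, a)).reverse ++ b := by
      intro l
      induction l with
      | nil => simp
      | cons a l ih => intro b; cases h : f (s, a) <;> simp [ih, h]
    simp [key]
  · have := codeSize_le_of_mem ha
    cases f (s, a)
    · exact Nat.le_add_right _ _
    · simp only [cond_true, codeSize_cons]; omega

theorem not {f : σ → Bool} (hf : PolyTime f) : PolyTime fun s => !f s := by
  convert hf.cond (const false) (const true) using 2 with s
  cases f s <;> rfl

theorem and {f g : σ → Bool} (hf : PolyTime f) (hg : PolyTime g) :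
    PolyTime fun s => f s && g s := by
  convert hf.cond hg (const false) using 2 with s
  cases f s <;> rfl

theorem or {f g : σ → Bool} (hf : PolyTime f) (hg : PolyTime g) :
    PolyTime fun s => f s || g s := by
  convert hf.cond (const true) hg using 2 with s
  cases f s <;> rfl

theorem isEmpty {l : σ → List α} (hl : PolyTime l) : PolyTime fun s => (l s).isEmpty := by
  classical
  convert hl.decide_eq (const []) using 2 with s
  cases l s <;> simp

theorem all {l : σ → List α} {f : σ × α → Bool} (hl : PolyTime l)
    (hf : PolyTime f) : PolyTime fun s => (l s).all fun a => f (s, a) := by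
  convert (hl.filter hf.not).isEmpty using 2 with s
  rw [Bool.eq_iff_iff]
  simp

theorem any {l : σ → List α} {f : σ × α → Bool} (hl : PolyTime l)
    (hf : PolyTime f) : PolyTime fun s => (l s).any fun a => f (s, a) := by
  convert (hl.all hf.not).not using 2 with s
  rw [Bool.eq_iff_iff]
  simp

theorem mem {l : σ → List α} {f : σ → α} [∀ s, Decidable (f s ∈ l s)] (hl : PolyTime l)
    (hf : PolyTime f) : PolyTime fun s => decide (f s ∈ l s) := by
  classical
  convert hl.any ((hf.comp fst).decide_eq snd) using 2 with s
  rw [Bool.eq_iff_iff]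
  simp

theorem flatten {l : σ → List (List α)} (hl : PolyTime l) : PolyTime fun s => (l s).flatten := by
  have h := foldl_of_growth (f := fun q => q.2.1 ++ q.2.2) hl (const ([] : List α))
    ((fst.comp snd).append (snd.comp snd)) hl.1 fun s b a ha => ?_
  · convert h using 2 with s
    have key : ∀ (l : List (List α)) (b : List α),
        l.foldl (fun l a => l ++ a) b = b ++ l.flatten := by
      intro l
      induction l with
      | nil => simp
      | cons a l ih => intro b; simp [ih]
    simp [key]
  · have h₁ := codeSize_le_of_mem ha
    have h₂ := codeSize_append b a
    dsimp only
    omega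

theorem flatMap {l : σ → List α} {f : σ × α → List β} (hl : PolyTime l)
    (hf : PolyTime f) : PolyTime fun s => (l s).flatMap fun a => f (s, a) := by
  simpa [List.flatMap_def] using (hl.map hf).flatten

theorem nodup [DecidableEq α] {l : σ → List α} (hl : PolyTime l) :
    PolyTime fun s => decide (l s).Nodup := by
  convert hl.all ((tail.comp ((hl.comp fst).filter
    (snd.decide_eq (snd.comp fst)))).isEmpty) using 2 with s
  have count_le_one_iff (a : α) :
      ((l s).filter fun b => decide (b = a)).tail = [] ↔ (l s).count a ≤ 1 := by
    rw [List.count_eq_length_filter, ← List.length_eq_zero_iff, List.length_tail]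
    simp only [beq_eq_decide]
    omega
  rw [Bool.eq_iff_iff]
  simp only [decide_eq_true_eq, List.all_eq_true, List.isEmpty_iff, count_le_one_iff,
    List.nodup_iff_count_le_one]
  refine ⟨fun h a _ => h a, fun h a => ?_⟩
  by_cases ha : a ∈ l s
  · exact h a ha
  · rw [List.count_eq_zero_of_not_mem ha]
    exact Nat.zero_le _

theorem finite_cases [Finite α] [Inhabited α] {k : σ → α} {f : α → σ → β} (hk : PolyTime k)
    (hf : ∀ a, PolyTime (f a)) : PolyTime fun s => f (k s) s := by
  classical
  have := Fintype.ofFinite α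
  have cases_of_mem : ∀ l : List α, PolyTime fun s => f (if k s ∈ l then k s else default) s := by
    intro l
    induction l with
    | nil => simpa using hf default
    | cons a l ih =>
      convert (hk.decide_eq (const a)).cond (hf a) ih using 2 with s
      by_cases h : k s = a <;> simp [h]
  simpa using cases_of_mem Finset.univ.toList

theorem of_finite [Finite α] [Inhabited α] (f : α → β) : PolyTime f :=
  finite_cases (f := fun a _ => f a) .id fun _ => const _

end PolyTime

end

/-! ### From flowcharts to Turing machines -/

/-- The unary code of a natural number; it has size `2 * n + 1`. -/
def rightComb : ℕ → Tree
  | 0 => .leaf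
  | n + 1 => .node .leaf (rightComb n)

/-- An enumeration of the alphabet `Γ'`. -/
def symbolIndex : Γ' → ℕ
  | .blank => 0
  | .bit false => 1
  | .bit true => 2
  | .bra => 3
  | .ket => 4
  | .comma => 5

instance : TreeEncodable Γ' where
  encode s := rightComb (symbolIndex s)
  encode_injective := by
    rintro (_ | (_ | _) | _ | _ | _) (_ | (_ | _) | _ | _ | _) <;> simp [rightComb, symbolIndex]

theorem codeSize_symbol_le (s : Γ') : codeSize s ≤ 11 := by
  rcases s with _ | (_ | _) | _ | _ | _ <;> decide

theorem codeSize_word_le (w : List Γ') : codeSize w ≤ 12 * w.length + 1 := by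
  induction w with
  | nil => exact codeSize_nil.le
  | cons s w ih =>
    have := codeSize_symbol_le s
    rw [codeSize_cons, List.length_cons]
    omega

namespace Flowchart

/-- Moves everything on the main stack to `left`, which reverses it. -/
def flush : Flowchart Unit :=
  loop ((pop .main).bind fun
    | some s => (push .left s).seq (ret none)
    | none => ret (some ()))

theorem run_flush (w : List Γ') : ∀ x y z : List Γ',
    flush.Run ⟨w, x, y, z⟩ (3 * w.length + 2) () ⟨[], w.reverse ++ x, y, z⟩ := by
  induction w with
  | nil =>
    intro x y z
    exact Run.mono (Run.loop_exit (Run.bind (e := none) (run_pop ..) (run_ret ..))) le_rfl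
  | cons s w ih =>
    intro x y z
    have h := ih (s :: x) y z
    rw [List.reverse_cons, List.append_assoc]
    exact Run.mono (Run.loop_next (Run.bind (e := some s) (run_pop ..)
      (Run.seq (run_push ..) (run_ret ..))) h) (by rw [List.length_cons]; omega)

/-- Pops the symbols from `left` and prepends them to the list encoded on the main stack. -/
def encodeSymbols : Flowchart Unit :=
  loop ((pop .left).bind fun
    | some s => (pushWord (.bit true :: (encode s).word)).seq (ret none)
    | none => ret (some ()))

theorem run_encodeSymbols (w : List Γ') : ∀ l x y : List Γ',
    encodeSymbols.Run ⟨(encode l).word, w, x, y⟩ (16 * w.length + 2) ()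
      ⟨(encode (w.reverse ++ l)).word, [], x, y⟩ := by
  induction w with
  | nil =>
    intro l x y
    exact Run.mono (Run.loop_exit (Run.bind (e := none) (run_pop ..) (run_ret ..))) le_rfl
  | cons s w ih =>
    intro l x y
    have h := ih (s :: l) x y
    rw [List.reverse_cons, List.append_assoc]
    refine Run.mono (Run.loop_next (Run.bind (e := some s) (run_pop ..)
      (Run.seq (run_pushWord ..) (run_ret ..))) h) ?_
    have h₁ : (encode s).word.length ≤ 11 := codeSize_symbol_le s
    simp only [List.length_cons]
    omega

/-- Replaces a word on the main stack by its code as a list of symbols. -/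
def encodeInput : Flowchart Unit := flush.seq ((push .main (.bit false)).seq encodeSymbols)

theorem run_encodeInput (w : List Γ') :
    encodeInput.Run ⟨w, [], [], []⟩ (19 * w.length + 5) () ⟨(encode w).word, [], [], []⟩ := by
  have h := run_encodeSymbols w.reverse [] [] []
  rw [List.reverse_reverse, List.append_nil, List.length_reverse] at h
  have h' := run_flush w [] [] []
  rw [List.append_nil] at h'
  exact Run.mono (Run.seq h' (Run.seq (run_push ..) h)) (by omega)

/-- The alphabets of the stacks: the work stacks and, as `none`, a stack for the output. -/
abbrev Alphabet : Option Reg → Type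
  | none => Bool
  | some _ => Γ'

/-- The statement of the machine model for an instruction; popped symbols go through the memory. -/
def stmt {X : Type} : Instr X → Turing.TM2.Stmt Alphabet X (Option Γ')
  | .push k s x => .push (some k) (fun _ => s) (.goto fun _ => x)
  | .pop k f => .pop (some k) (fun _ o => o) (.goto f)
  | .jump x => .goto fun _ => x

/-- The Turing machine that runs a flowchart and writes the exit to the output stack. -/
def machine (F : Flowchart Bool) : Turing.FinTM2 :=
  haveI := F.fintypeLabel
  { K := Option Reg
    k₀ := some .main
    k₁ := none
    Γ := Alphabet
    Λ := F.Label ⊕ Bool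
    main := .inl F.start
    σ := Option Γ'
    initialState := none
    Γk₀Fin := inferInstanceAs (Fintype Γ')
    m
      | .inl l => stmt (F.code l)
      | .inr b => .push none (fun _ => b) (.load (fun _ => none) .halt) }

/-- The stacks of the machine, given the work stacks `S` and the output `o`. -/
def contents (S : Store) (o : List Bool) : ∀ k, List (Alphabet k)
  | none => o
  | some k => S.get k

theorem update_contents (S : Store) (o : List Bool) (k : Reg) (l : List Γ') :
    Function.update (contents S o) (some k) l = contents (S.set l k) o := by
  funext k'
  rcases k' with _ | k'
  · rfl
  · by_cases h : k' = k
    · subst h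
      refine (Function.update_self (some k') _ (contents S o)).trans ?_
      cases k' <;> rfl
    · refine (Function.update_of_ne (by simpa using h) _ (contents S o)).trans ?_
      cases k <;> cases k' <;> first | rfl | exact absurd rfl h

theorem step_machine (F : Flowchart Bool) (l : F.Label) (v : Option Γ') (S : Store)
    (o : List Bool) :
    ∃ v', (machine F).step ⟨some (.inl l), v, contents S o⟩ =
      some ⟨some ((F.code l).exec S).1, v', contents ((F.code l).exec S).2 o⟩ := by
  change ∃ v', some (Turing.TM2.stepAux (stmt (F.code l)) v (contents S o)) = _
  rcases F.code l with ⟨k, s, x⟩ | ⟨k, f⟩ | x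
  · exact ⟨v, congrArg (fun T => some (Turing.TM2.Cfg.mk (some x) v T)) (update_contents S o k _)⟩
  · exact ⟨(S.get k).head?, congrArg (fun T =>
      some (Turing.TM2.Cfg.mk (some (f (S.get k).head?)) (S.get k).head? T))
        (update_contents S o k _)⟩
  · exact ⟨v, rfl⟩

theorem Steps.machine {F : Flowchart Bool} {t : ℕ} {x y} (h : F.Steps t x y) :
    ∀ v : Option Γ', ∃ v',
    (flip Bind.bind (machine F).step)^[t] (some ⟨some x.1, v, contents x.2 []⟩) =
      some ⟨some y.1, v', contents y.2 []⟩ := by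
  induction h with
  | refl x => exact fun v => ⟨v, rfl⟩
  | @step l S t y _ ih =>
    intro v
    obtain ⟨v', hv'⟩ := step_machine F l v S []
    obtain ⟨v'', hv''⟩ := ih v'
    refine ⟨v'', ?_⟩
    rw [Function.iterate_succ_apply, ← hv'']
    exact congrArg _ hv'

theorem Run.machine {F : Flowchart Bool} {w : List Γ'} {T : ℕ} {b : Bool}
    (h : F.Run ⟨w, [], [], []⟩ T b ⟨[], [], [], []⟩) :
    Nonempty (Turing.TM2OutputsInTime (machine F) w (some [b]) (T + 1)) := by
  obtain ⟨t, ht, h⟩ := h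
  obtain ⟨v, hv⟩ := h.machine none
  refine ⟨⟨⟨t + 1, ?_⟩, Nat.succ_le_succ ht⟩⟩
  have h₁ : Turing.initList (F.machine) w =
      ⟨some (.inl F.start), none, contents ⟨w, [], [], []⟩ []⟩ := by
    refine congrArg (Turing.TM2.Cfg.mk _ _) (funext fun k => ?_)
    rcases k with _ | (_ | _ | _ | _) <;> rfl
  have h₂ : Turing.haltList (F.machine) [b] =
      ⟨none, none, contents ⟨[], [], [], []⟩ [b]⟩ := by
    refine congrArg (Turing.TM2.Cfg.mk _ _) (funext fun k => ?_)
    rcases k with _ | (_ | _ | _ | _) <;> rfl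
  rw [Function.iterate_succ_apply', Option.map_some, h₂]
  refine (congrArg (flip Bind.bind F.machine.step)
    ((congrArg _ (congrArg some h₁)).trans hv)).trans ?_
  change some (Turing.TM2.Cfg.mk none none _) = _
  refine congrArg (fun T => some (Turing.TM2.Cfg.mk none none T)) (funext fun k => ?_)
  rcases k with _ | (_ | _ | _ | _) <;> rfl

end Flowchart

open Flowchart in
theorem PolyTime.exists_flowchart {f : List Γ' → Bool} (hf : PolyTime f) :
    ∃ (F : Flowchart Bool) (p : Polynomial ℕ),
      ∀ w, F.Run ⟨w, [], [], []⟩ (p.eval w.length) (f w) ⟨[], [], [], []⟩ := by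
  obtain ⟨-, F, T, ⟨p, hp⟩, hF⟩ := hf
  refine ⟨encodeInput.seq (F.seq ((pop .main).bind fun
    | some (.bit true) => (pop .main).bind fun _ => (pop .main).bind fun _ => ret true
    | _ => ret false)), 19 * .X + 5 + (p.comp (12 * .X + 1) + 4), fun w => ?_⟩
  have hT : T w ≤ p.eval (12 * w.length + 1) :=
    (hp w).trans (monotone_eval p (codeSize_word_le w))
  have hFw := hF w [] [] [] []
  rw [List.append_nil, List.append_nil] at hFw
  refine Run.mono (Run.seq (run_encodeInput w) (Run.seq hFw (T' := 4) ?_)) ?_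
  · cases f w
    · exact Run.mono (Run.bind (e := some (Γ'.bit false)) (run_pop ..) (run_ret ..)) (by omega)
    · exact Run.mono (Run.bind (e := some (Γ'.bit true)) (run_pop ..)
        (Run.bind (e := some (Γ'.bit false)) (run_pop ..)
          (Run.bind (e := some (Γ'.bit false)) (run_pop ..) (run_ret ..)))) le_rfl
  · simpa using hT

open Flowchart in
theorem PolyTime.inP {f : List Γ' → Bool} (hf : PolyTime f) {L : Language Γ'}
    (hL : ∀ w, f w = true ↔ w ∈ L) : InP L := by
  obtain ⟨F, p, hF⟩ := hf.exists_flowchart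
  refine ⟨f, ⟨⟨machine F, Equiv.refl Γ', Equiv.refl Bool⟩, p + 1, fun w => ?_⟩, ?_, hL⟩
  · rw [Polynomial.eval_add, Polynomial.eval_one]
    have input_eq : List.map (Equiv.refl Γ').invFun (_root_.id w) = w := List.map_id _
    exact input_eq.symm ▸ (hF w).machine.some
  · rintro (_ | _)
    · exact inferInstanceAs (Finite Bool)
    · exact inferInstanceAs (Finite Γ')

/-! ### Numbers, cells and the description of a game as data -/

section

variable {α β γ σ : Type} [TreeEncodable α] [TreeEncodable β] [TreeEncodable γ] [TreeEncodable σ]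

instance : TreeEncodable ℕ where
  encode n := encode (encodeNat n)
  encode_injective := encode_injective.comp encodingNatBool.encode_injective

instance : TreeEncodable ℤ where
  encode z := encode (decide (z < 0), z.natAbs)
  encode_injective := encode_injective.comp fun x y h => by
    simp only [Prod.mk.injEq, decide_eq_decide] at h
    omega

/-- The successor of a number in binary, least significant digit first. -/
def incBits : List Bool → List Bool
  | [] => [true]
  | false :: l => true :: l
  | true :: l => false :: incBits l

theorem encodePosNum_succ (n : PosNum) : encodePosNum n.succ = incBits (encodePosNum n) := by
  induction n with
  | one => rfl
  | bit1 n ih => simp [PosNum.succ, encodePosNum, incBits, ih]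
  | bit0 n => simp [PosNum.succ, encodePosNum, incBits]

theorem encodeNat_succ (n : ℕ) : encodeNat (n + 1) = incBits (encodeNat n) := by
  unfold encodeNat
  rw [Nat.cast_succ, Num.add_one]
  rcases (n : Num) with _ | n
  · rfl
  · exact encodePosNum_succ n

theorem encodeNat_bit1 (n : ℕ) : encodeNat (2 * n + 1) = true :: encodeNat n := by
  unfold encodeNat
  have h : ((2 * n + 1 : ℕ) : Num) = Num.bit1 (n : Num) := by
    rw [← Num.bit1_of_bit1]
    push_cast
    ring
  rw [h]
  rcases (n : Num) with _ | n <;> rfl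

/-- One step of the addition of a carry bit; the digits of the sum are collected in reverse. -/
def addCarry (x : Bool × List Bool) (b : Bool) : Bool × List Bool :=
  (x.1 && b, (x.1 ^^ b) :: x.2)

theorem foldl_addCarry_false (l : List Bool) :
    ∀ r, l.foldl addCarry (false, r) = (false, l.reverse ++ r) := by
  induction l with
  | nil => exact fun _ => rfl
  | cons b l ih => intro r; simp [addCarry, ih]

theorem reverse_append_incBits (l : List Bool) : ∀ r : List Bool, r.reverse ++ incBits l =
    bif (l.foldl addCarry (true, r)).1 then (l.foldl addCarry (true, r)).2.reverse ++ [true]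
    else (l.foldl addCarry (true, r)).2.reverse := by
  induction l with
  | nil => simp [incBits]
  | cons b l ih =>
    intro r
    cases b
    · simp [addCarry, incBits, foldl_addCarry_false]
    · simpa [addCarry, incBits] using ih (false :: r)

theorem length_incBits_le (l : List Bool) : (incBits l).length ≤ l.length + 1 := by
  induction l with
  | nil => simp [incBits]
  | cons b l ih => cases b <;> simp [incBits]; omega

theorem length_encodeNat_le (n : ℕ) : (encodeNat n).length ≤ n := by
  induction n with
  | zero => exact le_rfl
  | succ n ih =>
    rw [encodeNat_succ]
    have := length_incBits_le (encodeNat n)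
    omega

theorem codeSize_bits_le (l : List Bool) : codeSize l ≤ 4 * l.length + 1 := by
  induction l with
  | nil => exact codeSize_nil.le
  | cons b l ih =>
    have := codeSize_bool_le b
    rw [codeSize_cons, List.length_cons]
    omega

theorem codeSize_nat_le (n : ℕ) : codeSize n ≤ 4 * n + 1 := by
  have h₁ := codeSize_bits_le (encodeNat n)
  have h₂ := length_encodeNat_le n
  have h₃ : codeSize n = codeSize (encodeNat n) := rfl
  omega

theorem codeSize_reverse_range_le (n : ℕ) :
    codeSize (List.range n).reverse ≤ 4 * n * n + 2 * n + 1 := by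
  induction n with
  | zero => exact codeSize_nil.le
  | succ n ih =>
    rw [List.range_succ, List.reverse_append, List.reverse_singleton, List.singleton_append,
      codeSize_cons]
    have := codeSize_nat_le n
    nlinarith

theorem foldl_count_cons {α : Type} (l : List α) :
    l.foldl (fun (b : ℕ × List ℕ) _ => (b.1 + 1, b.1 :: b.2)) (0, []) =
      (l.length, (List.range l.length).reverse) := by
  induction l using List.reverseRecOn with
  | nil => rfl
  | append_singleton l a ih => simp [List.foldl_append, ih, List.range_succ]

/-- The word of digits has no superfluous zeros, least significant digit first. -/
def canonical (l : List Bool) : Bool := l.reverse.headD true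

theorem encodePosNum_decodePosNum (l : List Bool) (hl : l ≠ []) (h : canonical l = true) :
    encodePosNum (decodePosNum l) = l := by
  induction l with
  | nil => exact absurd rfl hl
  | cons b l ih =>
    by_cases hl' : l = []
    · subst hl'
      cases b
      · simp [canonical] at h
      · rfl
    · have h' : canonical l = true := by
        rw [← h]
        unfold canonical
        rw [List.reverse_cons]
        cases hr : l.reverse with
        | nil => exact absurd (List.reverse_eq_nil_iff.1 hr) hl'
        | cons x r => rfl
      cases b <;> simp [decodePosNum, encodePosNum, hl', ih hl' h']

theorem encodeNat_decodeNat (l : List Bool) (h : canonical l = true) :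
    encodeNat (decodeNat l) = l := by
  unfold encodeNat decodeNat
  rw [Num.of_to_nat]
  by_cases hl : l = []
  · subst hl; rfl
  · rw [decodeNum, if_neg hl, PosNum.cast_to_num]
    exact encodePosNum_decodePosNum l hl h

theorem canonical_encodePosNum (n : PosNum) : canonical (encodePosNum n) = true := by
  induction n with
  | one => rfl
  | bit1 n ih | bit0 n ih =>
    unfold canonical at ih ⊢
    rw [encodePosNum, List.reverse_cons]
    cases hr : (encodePosNum n).reverse with
    | nil => exact absurd (List.reverse_eq_nil_iff.1 hr) (encodePosNum_nonempty n)
    | cons x r => simpa [hr] using ih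

theorem canonical_encodeNat (n : ℕ) : canonical (encodeNat n) = true := by
  unfold encodeNat
  rcases (n : Num) with _ | n
  · rfl
  · exact canonical_encodePosNum n

/-- The number with the given binary digits, or zero if they are not canonical. -/
def natOfBits (l : List Bool) : ℕ := bif canonical l then decodeNat l else 0

theorem natOfBits_encodeNat (n : ℕ) : natOfBits (encodeNat n) = n := by
  rw [natOfBits, canonical_encodeNat, cond_true, decode_encodeNat]

/-- The sign bit of an integer and the binary digits of its absolute value. -/
def intBits (z : ℤ) : List Bool := decide (z < 0) :: encodeNat z.natAbs

theorem encInt_eq (z : ℤ) : encInt z = (intBits z).map Γ'.bit := rfl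

/-- The integer with the given sign bit and binary digits, inverse to `intBits`. -/
def intOfBits (l : List Bool) : ℤ :=
  bif l.headD false then -(natOfBits l.tail : ℤ) else natOfBits l.tail

theorem intOfBits_intBits (z : ℤ) : intOfBits (intBits z) = z := by
  unfold intOfBits intBits
  simp only [List.headD_cons, List.tail_cons, natOfBits_encodeNat]
  by_cases h : z < 0
  · simp only [h, decide_true, cond_true]; omega
  · simp only [h, decide_false, cond_false]; omega

namespace PolyTime

theorem congr_encode {f : α → β} {g : α → γ} (hg : PolyTime g)
    (h : ∀ a, encode (f a) = encode (g a)) : PolyTime f := by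
  obtain ⟨hgs, F, T, hT, hF⟩ := hg
  exact ⟨hgs.mono fun a => (congrArg Tree.size (h a)).le, F, T, hT, fun a => by rw [h]; exact hF a⟩

theorem encodeNat : PolyTime encodeNat := of_encode_eq fun _ => rfl

theorem odd : PolyTime fun n : ℕ => 2 * n + 1 :=
  congr_encode ((const true).cons encodeNat) fun n => congrArg encode (encodeNat_bit1 n)

theorem xor {f g : σ → Bool} (hf : PolyTime f) (hg : PolyTime g) :
    PolyTime fun s => Bool.xor (f s) (g s) := by
  convert hf.cond hg.not hg using 2 with s
  cases f s <;> cases g s <;> rfl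

theorem incBits : PolyTime incBits := by
  have h := foldl_of_growth (f := fun q : List Bool × (Bool × List Bool) × Bool =>
      addCarry q.2.1 q.2.2) (d := fun _ => 10) PolyTime.id (const (true, []))
    (((fst.comp (fst.comp snd)).and (snd.comp snd)).pair
      (((fst.comp (fst.comp snd)).xor (snd.comp snd)).cons (snd.comp (fst.comp snd))))
    (.const _) fun s x b _ => ?_
  · convert (fst.comp h).cond ((snd.comp h).reverse.append (const [true]))
      (snd.comp h).reverse using 2 with l
    exact reverse_append_incBits l []
  · have h₁ := codeSize_bool_le (x.1 && b)
    have h₂ := codeSize_bool_le (x.1 ^^ b)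
    have h₃ : codeSize x = codeSize x.1 + codeSize x.2 + 1 := codeSize_pair ..
    simp only [addCarry, codeSize_pair, codeSize_cons]
    omega

theorem succ : PolyTime fun n : ℕ => n + 1 :=
  congr_encode (incBits.comp encodeNat) fun n => congrArg encode (encodeNat_succ n)

theorem range_length {l : σ → List α} (hl : PolyTime l) :
    PolyTime fun s => List.range (l s).length := by
  have h := foldl (f := fun q : σ × (ℕ × List ℕ) × α => (q.2.1.1 + 1, q.2.1.1 :: q.2.1.2))
    (N := fun s => 4 * (codeSize (l s) * codeSize (l s)) + (6 * codeSize (l s) + 3)) hl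
    (const (0, [])) ((succ.comp (fst.comp (fst.comp snd))).pair
      ((fst.comp (fst.comp snd)).cons (snd.comp (fst.comp snd))))
    (((PolyBounded.const 4).mul (hl.1.mul hl.1)).add (((PolyBounded.const 6).mul hl.1).add
      (.const 3))) fun s l' hl' => ?_
  · simpa [foldl_count_cons] using (snd.comp h).reverse
  · have hlen : l'.length ≤ codeSize (l s) := hl'.length_le.trans (length_lt_codeSize _).le
    have h₁ := codeSize_nat_le l'.length
    have h₂ := codeSize_reverse_range_le l'.length
    simp only [foldl_count_cons, codeSize_pair]
    nlinarith [Nat.mul_le_mul hlen hlen]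

theorem canonical : PolyTime canonical := (headD true).comp PolyTime.id.reverse

theorem natOfBits : PolyTime natOfBits := by
  refine congr_encode (canonical.cond PolyTime.id (const [])) fun l => ?_
  rw [Rikudo.natOfBits]
  change encode (Computability.encodeNat _) = _
  cases h : Rikudo.canonical l
  · rfl
  · rw [cond_true, cond_true, encodeNat_decodeNat l h]

theorem isNeg : PolyTime fun z : ℤ => decide (z < 0) :=
  fst.comp (of_encode_eq (f := fun z : ℤ => (decide (z < 0), z.natAbs)) fun _ => rfl)

theorem natAbs : PolyTime Int.natAbs :=
  snd.comp (of_encode_eq (f := fun z : ℤ => (decide (z < 0), z.natAbs)) fun _ => rfl)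

theorem intOfBits : PolyTime intOfBits := by
  have h := natOfBits.comp (tail (α := Bool))
  refine congr_encode (((headD false).and (h.decide_eq (const 0)).not).pair h) fun l => ?_
  change encode (decide (Rikudo.intOfBits l < 0), (Rikudo.intOfBits l).natAbs) = _
  congr 1
  unfold Rikudo.intOfBits
  cases l.headD false
  · simp
  · rw [cond_true]
    refine Prod.ext ?_ (by simp)
    rw [Bool.eq_iff_iff]
    simp
    omega

theorem symbol_bit {f : σ → Bool} (hf : PolyTime f) : PolyTime fun s => Γ'.bit (f s) :=
  (of_finite Γ'.bit).comp hf

theorem encNat : PolyTime encNat := encodeNat.map (symbol_bit snd)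

theorem encInt : PolyTime encInt := (symbol_bit isNeg).cons (encNat.comp natAbs)

theorem encCell : PolyTime encCell :=
  (encInt.comp fst).append ((const Γ'.comma).cons (encInt.comp snd))

theorem encList {e : α → List Γ'} (he : PolyTime e) : PolyTime (encList e) :=
  PolyTime.id.flatMap (((const Γ'.bra).cons (he.comp snd)).append (const [Γ'.ket]))

end PolyTime

/-- The data a word lists: cells, placed numbers and adjacencies. -/
abbrev Data := List Cell × List (Cell × ℕ) × List (Cell × Cell)

theorem PolyTime.encLists : PolyTime fun x : Data => encLists x.1 x.2.1 x.2.2 :=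
  (((PolyTime.encList encCell).comp fst).append ((const Γ'.comma).cons
    ((PolyTime.encList ((encCell.comp fst).append ((const Γ'.comma).cons
      (encNat.comp snd)))).comp (fst.comp snd)))).append ((const Γ'.comma).cons
    ((PolyTime.encList ((encCell.comp fst).append ((const Γ'.comma).cons
      (encCell.comp snd)))).comp (snd.comp snd)))

end

/-! ### Parsing -/

section

variable {σ : Type} [TreeEncodable σ]

/-- The state of the parser, which reads from right to left: whether it is inside brackets, the
comma-separated fields of the current entry, and the lists of entries read so far. -/
abbrev ParseState := Bool × List (List Bool) × List (List (List (List Bool)))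

/-- The effect of the symbol `s` on the state of the parser. A comma separates fields inside
brackets and lists outside of them. -/
def parseStep (s : Γ') (x : ParseState) : ParseState :=
  match s with
  | .blank => x
  | .bit b => (x.1, (b :: x.2.1.headD []) :: x.2.1.tail, x.2.2)
  | .bra => (false, [], (x.2.1 :: x.2.2.headD []) :: x.2.2.tail)
  | .ket => (true, [[]], x.2.2)
  | .comma => bif x.1 then (true, [] :: x.2.1, x.2.2) else (false, x.2.1, [] :: x.2.2)

/-- The state of the parser after it has read the word `w` from right to left. -/
def parseWord (w : List Γ') : ParseState := w.foldr parseStep (false, [], [[]])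

/-- The cell whose coordinates are given by the first two fields of an entry. -/
def cellOfFields (l : List (List Bool)) : Cell :=
  (intOfBits (l.headD []), intOfBits (l.tail.headD []))

/-- The lists described by a word, if there are any. -/
def parse (w : List Γ') : Data :=
  let x := (parseWord w).2.2
  ((x.headD []).map cellOfFields,
    (x.tail.headD []).map (fun l => (cellOfFields l, natOfBits (l.tail.tail.headD []))),
    (x.tail.tail.headD []).map fun l => (cellOfFields l, cellOfFields l.tail.tail))

theorem foldr_parseStep_bits (l : List Bool) (b : Bool) (h : List Bool) (t : List (List Bool))
    (x : List (List (List (List Bool)))) :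
    (l.map Γ'.bit).foldr parseStep (b, h :: t, x) = (b, (l ++ h) :: t, x) := by
  induction l with
  | nil => rfl
  | cons c l ih => simp [ih, parseStep]

theorem parseStep_comma (t : List (List Bool)) (x : List (List (List (List Bool)))) :
    parseStep .comma (true, t, x) = (true, [] :: t, x) := rfl

theorem foldr_parseStep_cell (c : Cell) (t : List (List Bool))
    (x : List (List (List (List Bool)))) :
    (encCell c).foldr parseStep (true, [] :: t, x) =
      (true, intBits c.1 :: intBits c.2 :: t, x) := by
  simp [encCell, encInt_eq, foldr_parseStep_bits, parseStep_comma]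

theorem foldr_parseStep_encList {α : Type} (e : α → List Γ') (d : α → List (List Bool))
    (he : ∀ a x, (e a).foldr parseStep (true, [[]], x) = (true, d a, x))
    (l : List α) (h : List (List (List Bool))) (x : List (List (List (List Bool)))) :
    (encList e l).foldr parseStep (false, [], h :: x) = (false, [], (l.map d ++ h) :: x) := by
  induction l with
  | nil => rfl
  | cons a l ih =>
    rw [encList, List.flatMap_cons, List.foldr_append]
    rw [encList] at ih
    rw [ih, List.cons_append, List.foldr_cons, List.foldr_append, List.foldr_cons, List.foldr_nil,
      show parseStep .ket (false, [], (l.map d ++ h) :: x) = (true, [[]], (l.map d ++ h) :: x)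
        from rfl, he]
    rfl

theorem parse_encLists (x : Data) : parse (encLists x.1 x.2.1 x.2.2) = x := by
  obtain ⟨cells, placed, links⟩ := x
  have h : parseWord (encLists cells placed links) = (false, [],
      [cells.map fun c => [intBits c.1, intBits c.2],
        placed.map fun e => [intBits e.1.1, intBits e.1.2, encodeNat e.2],
        links.map fun e => [intBits e.1.1, intBits e.1.2, intBits e.2.1, intBits e.2.2]]) := by
    have h_cells := foldr_parseStep_encList encCell (fun c => [intBits c.1, intBits c.2])
      fun c x => foldr_parseStep_cell c [] x
    have h_placed := foldr_parseStep_encList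
      (fun e : Cell × ℕ => encCell e.1 ++ Γ'.comma :: encNat e.2)
      (fun e => [intBits e.1.1, intBits e.1.2, encodeNat e.2]) fun e x => by
        simp [encNat, foldr_parseStep_bits, parseStep_comma, foldr_parseStep_cell]
    have h_links := foldr_parseStep_encList
      (fun e : Cell × Cell => encCell e.1 ++ Γ'.comma :: encCell e.2)
      (fun e => [intBits e.1.1, intBits e.1.2, intBits e.2.1, intBits e.2.2]) fun e x => by
        simp [parseStep_comma, foldr_parseStep_cell]
    have h_comma : ∀ x, parseStep .comma (false, [], x) = (false, [], [] :: x) := fun _ => rfl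
    unfold parseWord encLists
    simp [h_cells, h_placed, h_links, h_comma]
  simp only [parse, h]
  simp [cellOfFields, intOfBits_intBits, natOfBits_encodeNat, Function.comp_def]

theorem codeSize_parseStep_le (s : Γ') (x : ParseState) :
    codeSize (parseStep s x) ≤ codeSize x + 20 := by
  obtain ⟨b, t, l⟩ := x
  have hb := codeSize_pos b
  have ht := codeSize_pos t
  have h_true : codeSize true = 3 := rfl
  have h_false : codeSize false = 1 := rfl
  have h_nil {α : Type} [TreeEncodable α] : codeSize ([] : List α) = 1 := codeSize_nil
  rcases s with _ | c | _ | _ | _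
  · simp [parseStep]
  · have hc := codeSize_bool_le c
    rcases t with _ | ⟨f, t⟩ <;> simp [parseStep, codeSize_pair, codeSize_cons, h_nil] <;> omega
  · rcases l with _ | ⟨f, l⟩ <;> simp [parseStep, codeSize_pair, codeSize_cons, h_nil] <;> omega
  · simp [parseStep, codeSize_pair, codeSize_cons, h_nil]; omega
  · cases b <;> simp [parseStep, codeSize_pair, codeSize_cons, h_nil] <;> omega

namespace PolyTime

theorem parseStep {s : σ → Γ'} {x : σ → ParseState} (hs : PolyTime s) (hx : PolyTime x) :
    PolyTime fun a => parseStep (s a) (x a) := by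
  have h₁ := fst.comp hx
  have h₂ := fst.comp (snd.comp hx)
  have h₃ := snd.comp (snd.comp hx)
  refine finite_cases (f := fun s a => Rikudo.parseStep s (x a)) hs fun s => ?_
  rcases s with _ | b | _ | _ | _
  · exact hx
  · exact h₁.pair ((((const b).cons ((headD []).comp h₂)).cons (tail.comp h₂)).pair h₃)
  · exact (const false).pair ((const []).pair
      ((h₂.cons ((headD []).comp h₃)).cons (tail.comp h₃)))
  · exact (const true).pair ((const [[]]).pair h₃)
  · exact h₁.cond ((const true).pair (((const []).cons h₂).pair h₃))
      ((const false).pair (h₂.pair ((const []).cons h₃)))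

theorem parseWord : PolyTime parseWord := by
  have h := foldl_of_growth (f := fun q : List Γ' × ParseState × Γ' =>
      Rikudo.parseStep q.2.2 q.2.1) PolyTime.id.reverse (const (false, [], [[]]))
    ((snd.comp snd).parseStep (fst.comp snd)) (.const 20)
    fun _ x s _ => codeSize_parseStep_le s x
  convert h using 2 with w
  rw [List.foldl_reverse]
  rfl

theorem cellOfFields {f : σ → List (List Bool)} (hf : PolyTime f) :
    PolyTime fun s => cellOfFields (f s) :=
  (intOfBits.comp ((headD []).comp hf)).pair (intOfBits.comp ((headD []).comp (tail.comp hf)))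

theorem parse : PolyTime parse := by
  have h : PolyTime fun w => (Rikudo.parseWord w).2.2 := snd.comp (snd.comp parseWord)
  exact (((headD []).comp h).map (cellOfFields snd)).pair
    ((((headD []).comp (tail.comp h)).map ((cellOfFields snd).pair
      (natOfBits.comp ((headD []).comp (tail.comp (tail.comp snd)))))).pair
    (((headD []).comp (tail.comp (tail.comp h))).map ((cellOfFields snd).pair
      (cellOfFields (tail.comp (tail.comp snd))))))

end PolyTime

end

/-! ### The decision procedure -/

section Matching

variable {α : Type} [DecidableEq α]

/-- The lists `B` and `C` have a common entry. -/
def meets (C B : List α) : Bool := B.any fun a => decide (a ∈ C)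

/-- One step of the greedy matching: the blocks that meet `C` are merged into one block, or
discarded if there is only one. The Boolean records whether every `C` so far met a block. -/
def matchStep (x : Bool × List (List α)) (C : List α) : Bool × List (List α) :=
  (x.1 && !(x.2.filter (meets C)).isEmpty,
    bif (x.2.filter (meets C)).tail.isEmpty then x.2.filter fun B => !meets C B
    else (x.2.filter (meets C)).flatten :: x.2.filter fun B => !meets C B)

/-- The greedy decision whether the lists `Cs` have distinct representatives in `U`; it is correct
if at most the last of the lists has more than two entries. -/
def hasRepresentatives (U : List α) (Cs : List (List α)) : Bool :=
  (Cs.foldl matchStep (true, U.map fun u => [u])).1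

end Matching

/-- Adjacency of cells, as a Boolean test. -/
def isAdj (c c' : Cell) : Bool :=
  (decide (c'.1 = c.1 + 1) && decide (c.2 = c'.2)) ||
  ((decide (c.1 = c'.1 + 1) && decide (c.2 = c'.2)) ||
  ((decide (c.1 = c'.1) && decide (c'.2 = c.2 + 1)) ||
  ((decide (c.1 = c'.1) && decide (c.2 = c'.2 + 1)) ||
  ((decide (c'.1 = c.1 + 1) && decide (c.2 = c'.2 + 1)) ||
  (decide (c.1 = c'.1 + 1) && decide (c'.2 = c.2 + 1))))))

theorem isAdj_iff {c c' : Cell} : isAdj c c' = true ↔ hexGrid.Adj c c' := by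
  simp only [isAdj, hexGrid, Set.mem_insert_iff, Set.mem_singleton_iff, Prod.mk.injEq,
    Bool.or_eq_true, Bool.and_eq_true, decide_eq_true_eq]
  omega

namespace Data

abbrev cells (x : Data) : List Cell := x.1

abbrev placed (x : Data) : List (Cell × ℕ) := x.2.1

abbrev links (x : Data) : List (Cell × Cell) := x.2.2

/-- The cells that carry a number. -/
def placedCells (x : Data) : List Cell := x.placed.map fun e => e.1

/-- The cells without a number, which have to receive the even numbers. -/
def freeCells (x : Data) : List Cell := x.cells.filter fun c => !decide (c ∈ x.placedCells)

/-- The cells with the numbers `2 * i + 1` and `2 * i + 3`, between which `2 * i + 2` has to be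
placed; the second one is missing if `2 * i + 2` is the largest number. -/
def slot (x : Data) (i : ℕ) : List Cell :=
  (x.placed.filter fun e => decide (e.2 = 2 * i + 1) || decide (e.2 = 2 * (i + 1) + 1)).map
    fun e => e.1

/-- The free cells that can carry the number `2 * i + 2`: they are adjacent to the slot, and their
given adjacencies lead into it. -/
def candidates (x : Data) (i : ℕ) : List Cell :=
  x.freeCells.filter fun u => (x.slot i).all (fun c => isAdj c u) &&
    x.links.all fun e => (!decide (e.1 = u) || decide (e.2 ∈ x.slot i)) &&
      (!decide (e.2 = u) || decide (e.1 ∈ x.slot i))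

/-- The Boolean test for `Data.WellFormed`. -/
def isWellFormed (x : Data) : Bool :=
  !x.cells.isEmpty && (decide x.cells.Nodup && (decide x.links.Nodup &&
  (decide x.placedCells.Nodup &&
  (x.placedCells.all (fun c => decide (c ∈ x.cells)) &&
  ((List.range x.placed.length).all (fun i => x.placed.any fun e => decide (e.2 = 2 * i + 1)) &&
  ((decide (x.freeCells.length = x.placed.length) ||
    decide (x.freeCells.length + 1 = x.placed.length)) &&
  x.links.all (fun e =>
    decide (e.1 ∈ x.cells) && (decide (e.2 ∈ x.cells) && isAdj e.1 e.2))))))))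

/-- The decision whether the lists describe a game with the odd numbers placed that admits a
solution. -/
def isSolvable (x : Data) : Bool :=
  x.isWellFormed &&
  (x.links.all (fun e => !(decide (e.1 ∈ x.placedCells) && decide (e.2 ∈ x.placedCells))) &&
  hasRepresentatives x.freeCells ((List.range x.freeCells.length).map x.candidates))

end Data

/-- The decision procedure for 1-over-2-Rikudo. A word that is not the encoding of the lists parsed
from it describes no game. -/
def decideWord (w : List Γ') : Bool :=
  decide (encLists (parse w).1 (parse w).2.1 (parse w).2.2 = w) && (parse w).isSolvable

/-! ### The decision procedure takes polynomial time -/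

section

variable {α σ : Type} [TreeEncodable α] [TreeEncodable σ]

theorem codeSize_filter_add_codeSize_filter_not (p : α → Bool) (l : List α) :
    codeSize (l.filter p) + codeSize (l.filter fun a => !p a) = codeSize l + 1 := by
  induction l with
  | nil => simp [codeSize_nil]
  | cons a l ih => cases h : p a <;> simp [h, codeSize_cons] <;> omega

theorem codeSize_flatten_le (l : List (List α)) : codeSize l.flatten ≤ codeSize l := by
  induction l with
  | nil => exact le_rfl
  | cons a l ih =>
    have := codeSize_append a l.flatten
    rw [List.flatten_cons, codeSize_cons]
    omega

theorem codeSize_matchStep_le [DecidableEq α] (x : Bool × List (List α)) (C : List α) :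
    codeSize (matchStep x C) ≤ codeSize x + 10 := by
  obtain ⟨b, l⟩ := x
  have h₁ := codeSize_filter_add_codeSize_filter_not (meets C) l
  have h₂ := codeSize_flatten_le (l.filter (meets C))
  have h₃ := codeSize_bool_le (b && !(l.filter (meets C)).isEmpty)
  simp only [matchStep, codeSize_pair]
  cases (l.filter (meets C)).tail.isEmpty
  · rw [cond_false, codeSize_cons]; omega
  · rw [cond_true]; omega

namespace PolyTime

theorem meets [DecidableEq α] {f g : σ → List α} (hf : PolyTime f) (hg : PolyTime g) :
    PolyTime fun s => meets (f s) (g s) :=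
  hg.any ((hf.comp fst).mem snd)

theorem matchStep [DecidableEq α] {f : σ → Bool × List (List α)} {g : σ → List α}
    (hf : PolyTime f) (hg : PolyTime g) : PolyTime fun s => matchStep (f s) (g s) := by
  have h₁ := (snd.comp hf).filter (meets (hg.comp fst) snd)
  have h₂ := (snd.comp hf).filter (meets (hg.comp fst) snd).not
  exact ((fst.comp hf).and h₁.isEmpty.not).pair
    ((tail.comp h₁).isEmpty.cond h₂ (h₁.flatten.cons h₂))

theorem hasRepresentatives [DecidableEq α] {f : σ → List α} {g : σ → List (List α)}
    (hf : PolyTime f) (hg : PolyTime g) : PolyTime fun s => hasRepresentatives (f s) (g s) :=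
  fst.comp (foldl_of_growth
    (f := fun q : σ × (Bool × List (List α)) × List α => Rikudo.matchStep q.2.1 q.2.2) hg
    ((const true).pair (hf.map (snd.cons (const [])))) (matchStep (fst.comp snd) (snd.comp snd))
    (.const 10) fun _ x C _ => codeSize_matchStep_le x C)

theorem eq_add_one {f g : σ → ℤ} (hf : PolyTime f) (hg : PolyTime g) :
    PolyTime fun s => decide (g s = f s + 1) := by
  have h₁ := natAbs.comp hf
  have h₂ := natAbs.comp hg
  convert (isNeg.comp hf).cond
    (((isNeg.comp hg).or (h₂.decide_eq (const 0))).and (h₁.decide_eq (succ.comp h₂)))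
    ((isNeg.comp hg).not.and (h₂.decide_eq (succ.comp h₁))) using 2 with s
  rw [Bool.eq_iff_iff]
  by_cases h : f s < 0
  · simp only [h, decide_true, cond_true, Bool.and_eq_true, Bool.or_eq_true, decide_eq_true_eq]
    omega
  · simp only [h, decide_false, cond_false, Bool.and_eq_true, Bool.not_eq_true',
      decide_eq_true_eq, decide_eq_false_iff_not]
    omega

theorem isAdj {f g : σ → Cell} (hf : PolyTime f) (hg : PolyTime g) :
    PolyTime fun s => isAdj (f s) (g s) := by
  have f₁ := fst.comp hf
  have f₂ := snd.comp hf
  have g₁ := fst.comp hg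
  have g₂ := snd.comp hg
  exact ((eq_add_one f₁ g₁).and (f₂.decide_eq g₂)).or
    (((eq_add_one g₁ f₁).and (f₂.decide_eq g₂)).or
    (((f₁.decide_eq g₁).and (eq_add_one f₂ g₂)).or
    (((f₁.decide_eq g₁).and (eq_add_one g₂ f₂)).or
    (((eq_add_one f₁ g₁).and (eq_add_one g₂ f₂)).or
    ((eq_add_one g₁ f₁).and (eq_add_one f₂ g₂))))))

theorem length {l : σ → List α} (hl : PolyTime l) : PolyTime fun s => (l s).length := by
  have h := (headD 0).comp
    (((const false).cons (hl.map (f := fun _ => false) (const false))).range_length.reverse)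
  convert h using 2 with s
  simp [List.range_succ]

theorem cells : PolyTime Data.cells := fst

theorem placed : PolyTime Data.placed := fst.comp snd

theorem links : PolyTime Data.links := snd.comp snd

theorem placedCells : PolyTime Data.placedCells := placed.map (fst.comp snd)

theorem freeCells : PolyTime Data.freeCells :=
  cells.filter (mem (placedCells.comp fst) snd).not

theorem slot {f : σ → Data} {g : σ → ℕ} (hf : PolyTime f) (hg : PolyTime g) :
    PolyTime fun s => (f s).slot (g s) :=
  ((placed.comp hf).filter (((snd.comp snd).decide_eq (odd.comp (hg.comp fst))).or
    ((snd.comp snd).decide_eq (odd.comp (succ.comp (hg.comp fst)))))).map (fst.comp snd)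

theorem candidates {f : σ → Data} {g : σ → ℕ} (hf : PolyTime f) (hg : PolyTime g) :
    PolyTime fun s => (f s).candidates (g s) := by
  have h := slot hf hg
  have h' := (h.comp fst).comp (fst (α := σ × Cell) (β := Cell × Cell))
  have h_link : PolyTime fun q : (σ × Cell) × (Cell × Cell) =>
      (!decide (q.2.1 = q.1.2) || decide (q.2.2 ∈ (f q.1.1).slot (g q.1.1))) &&
      (!decide (q.2.2 = q.1.2) || decide (q.2.1 ∈ (f q.1.1).slot (g q.1.1))) :=
    (((fst.comp snd).decide_eq (snd.comp fst)).not.or (h'.mem (snd.comp snd))).and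
      (((snd.comp snd).decide_eq (snd.comp fst)).not.or (h'.mem (fst.comp snd)))
  exact (freeCells.comp hf).filter (((h.comp fst).all (isAdj snd (snd.comp fst))).and
    ((links.comp (hf.comp fst)).all h_link))

theorem isWellFormed : PolyTime Data.isWellFormed :=
  cells.isEmpty.not.and (cells.nodup.and (links.nodup.and (placedCells.nodup.and
    ((placedCells.all ((cells.comp fst).mem snd)).and
    ((placed.range_length.all ((placed.comp fst).any
      ((snd.comp snd).decide_eq (odd.comp (snd.comp fst))))).and
    (((freeCells.length.decide_eq placed.length).or
      ((succ.comp freeCells.length).decide_eq placed.length)).and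
    (links.all (((cells.comp fst).mem (fst.comp snd)).and
      (((cells.comp fst).mem (snd.comp snd)).and
      (isAdj (fst.comp snd) (snd.comp snd)))))))))))

theorem isSolvable : PolyTime Data.isSolvable :=
  isWellFormed.and ((links.all (((placedCells.comp fst).mem (fst.comp snd)).and
    ((placedCells.comp fst).mem (snd.comp snd))).not).and
    (hasRepresentatives freeCells (freeCells.range_length.map (candidates fst snd))))

theorem decideWord : PolyTime decideWord :=
  ((encLists.comp parse).decide_eq PolyTime.id).and (isSolvable.comp parse)

end PolyTime

end

/-! ### Correctness of the greedy matching -/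

section Matching

variable {α : Type} [DecidableEq α] {C : List α} {blocks : List (List α)}

theorem meets_iff {B : List α} : meets C B = true ↔ ∃ a ∈ B, a ∈ C := by
  simp [meets]

theorem meets_append {A B : List α} :
    meets C (A ++ B) = true ↔ meets C A = true ∨ meets C B = true := by
  simp [meets]

theorem length_filter_meets_le (h : blocks.Pairwise List.Disjoint) (C : List α) :
    (blocks.filter (meets C)).length ≤ C.length := by
  induction blocks generalizing C with
  | nil => simp
  | cons B blocks ih =>
    obtain ⟨hB, h⟩ := List.pairwise_cons.1 h
    by_cases hC : meets C B = true
    · obtain ⟨a, haB, haC⟩ := meets_iff.1 hC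
      have h_erase : ∀ D ∈ blocks, meets (C.erase a) D = meets C D := by
        intro D hD
        rw [Bool.eq_iff_iff, meets_iff, meets_iff]
        refine exists_congr fun b => and_congr_right fun hb => List.mem_erase_of_ne ?_
        rintro rfl
        exact hB D hD haB hb
      have := ih h (C.erase a)
      rw [List.filter_congr h_erase, List.length_erase_of_mem haC] at this
      have := List.length_pos_of_mem haC
      rw [List.filter_cons_of_pos hC, List.length_cons]
      omega
    · rw [List.filter_cons_of_neg hC]
      exact ih h C

theorem pairwise_disjoint_matchStep {x : Bool × List (List α)}
    (h : x.2.Pairwise List.Disjoint) (C : List α) :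
    (matchStep x C).2.Pairwise List.Disjoint := by
  have h_rest := h.filter fun B => !meets C B
  rw [matchStep]
  cases (x.2.filter (meets C)).tail.isEmpty
  · refine List.pairwise_cons.2 ⟨fun D hD a ha => ?_, h_rest⟩
    obtain ⟨B, hB, ha⟩ := List.mem_flatten.1 ha
    have hB := List.mem_filter.1 hB
    have hD := List.mem_filter.1 hD
    have : Std.Symm (List.Disjoint (α := α)) := ⟨fun _ _ h => h.symm⟩
    refine h.forall hB.1 hD.1 ?_ ha
    rintro rfl
    simp [hB.2] at hD
  · exact h_rest

/-- The lists `Cs` can be matched with blocks which they meet, every block being used at most as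
often as it occurs in `blocks`. -/
def Matchable (blocks : Multiset (List α)) (Cs : List (List α)) : Prop :=
  ∃ Bs : List (List α), (Bs : Multiset (List α)) ≤ blocks ∧
    List.Forall₂ (fun B C => meets C B = true) Bs Cs

variable {S T : Multiset (List α)} {Cs : List (List α)}

theorem matchable_nil : Matchable S [] :=
  ⟨[], Multiset.zero_le _, .nil⟩

theorem matchable_cons :
    Matchable S (C :: Cs) ↔ ∃ B T, S = B ::ₘ T ∧ meets C B = true ∧ Matchable T Cs := by
  constructor
  · rintro ⟨Bs', hS, h⟩
    obtain ⟨B, Bs, hB, hBs, rfl⟩ := List.forall₂_cons_right_iff.1 h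
    obtain ⟨T, rfl⟩ := Multiset.le_iff_exists_add.1 hS
    exact ⟨B, Bs + T, by rw [← Multiset.cons_coe, Multiset.cons_add], hB, Bs,
      Multiset.le_add_right _ _, hBs⟩
  · rintro ⟨B, T, rfl, hB, Bs, hT, h⟩
    exact ⟨B :: Bs, Multiset.cons_le_cons B hT, .cons hB h⟩

theorem cons_matchable_cons {A : List α} : Matchable (A ::ₘ S) (C :: Cs) ↔
    meets C A = true ∧ Matchable S Cs ∨
      ∃ B T, S = B ::ₘ T ∧ meets C B = true ∧ Matchable (A ::ₘ T) Cs := by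
  rw [matchable_cons]
  constructor
  · rintro ⟨B, T, h, hB, hT⟩
    rcases Multiset.cons_eq_cons.1 h with ⟨rfl, rfl⟩ | ⟨-, R, rfl, rfl⟩
    · exact .inl ⟨hB, hT⟩
    · exact .inr ⟨B, R, rfl, hB, hT⟩
  · rintro (⟨hA, hS⟩ | ⟨B, T, rfl, hB, hT⟩)
    · exact ⟨A, S, rfl, hA, hS⟩
    · exact ⟨B, A ::ₘ T, Multiset.cons_swap .., hB, hT⟩

theorem append_cons_matchable {A B : List α} :
    Matchable ((A ++ B) ::ₘ S) Cs ↔ Matchable (A ::ₘ S) Cs ∨ Matchable (B ::ₘ S) Cs := by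
  induction Cs generalizing S with
  | nil => simp [matchable_nil]
  | cons C Cs ih =>
    simp only [cons_matchable_cons, meets_append, ih, or_and_right, and_or_left, exists_or]
    exact or_or_or_comm

theorem matchable_cons_of_add (hS : ∀ B ∈ S, meets C B = true)
    (hT : ∀ B ∈ T, meets C B ≠ true) : Matchable (S + T) (C :: Cs) ↔
      ∃ B ∈ S, Matchable (S.erase B + T) Cs := by
  rw [matchable_cons]
  constructor
  · rintro ⟨B, R, h, hB, hR⟩
    have hBS : B ∈ S := (Multiset.mem_add.1 (h ▸ Multiset.mem_cons_self B R)).resolve_right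
      fun hBT => hT B hBT hB
    refine ⟨B, hBS, ?_⟩
    rwa [← Multiset.erase_add_left_pos T hBS, h, Multiset.erase_cons_head]
  · rintro ⟨B, hBS, h⟩
    exact ⟨B, S.erase B + T, by rw [← Multiset.cons_add, Multiset.cons_erase hBS], hS B hBS, h⟩

theorem matchable_singleton : Matchable blocks [C] ↔ blocks.filter (meets C) ≠ [] := by
  simp only [matchable_cons, matchable_nil, and_true, ne_eq, List.filter_eq_nil_iff, not_forall,
    not_not, exists_prop]
  constructor
  · rintro ⟨B, T, h, hB⟩
    exact ⟨B, Multiset.mem_coe.1 (h ▸ Multiset.mem_cons_self B T), hB⟩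
  · rintro ⟨B, h, hB⟩
    exact ⟨B, _, (Multiset.cons_erase (Multiset.mem_coe.2 h)).symm, hB⟩

-- If two blocks meet `C`, the one that is not used for `C` stays available for the other lists,
-- so the merged block stands for either of them.
theorem matchable_cons_iff_matchStep {x : Bool × List (List α)} (h : x.2.Pairwise List.Disjoint)
    (hC : C.length ≤ 2) : Matchable x.2 (C :: Cs) ↔
      x.2.filter (meets C) ≠ [] ∧ Matchable (matchStep x C).2 Cs := by
  have h_length := (length_filter_meets_le h C).trans hC
  have h_split : (x.2 : Multiset (List α)) = (x.2.filter (meets C) : List (List α)) +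
      (x.2.filter fun B => !meets C B : List (List α)) :=
    (Multiset.coe_eq_coe.2 (List.filter_append_perm _ _)).symm
  rw [h_split, matchable_cons_of_add (fun B hB => (List.mem_filter.1 hB).2)
    (fun B hB => by simpa using (List.mem_filter.1 hB).2), matchStep]
  generalize (x.2.filter fun B => !meets C B) = rest
  generalize x.2.filter (meets C) = M at h_length ⊢
  rcases M with _ | ⟨A, _ | ⟨B, _ | ⟨D, M⟩⟩⟩
  · simp
  · simp
  · have h_erase : (A ::ₘ {B}).erase B = {A} := by
      rw [← Multiset.insert_eq_cons, Multiset.pair_comm]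
      exact Multiset.erase_cons_head B {A}
    simp [-Multiset.coe_erase, ← Multiset.cons_coe, h_erase, append_cons_matchable,
      or_comm (a := Matchable (A ::ₘ _) _)]
  · simp at h_length

theorem foldl_matchStep (hCs : ∀ C ∈ Cs.dropLast, C.length ≤ 2) (x : Bool × List (List α))
    (hx : x.2.Pairwise List.Disjoint) :
    (Cs.foldl matchStep x).1 = true ↔ x.1 = true ∧ Matchable x.2 Cs := by
  induction Cs generalizing x with
  | nil => simp [matchable_nil]
  | cons C Cs ih =>
    have h_step : (matchStep x C).1 = true ↔ x.1 = true ∧ x.2.filter (meets C) ≠ [] := by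
      simp [matchStep, List.isEmpty_eq_false_iff]
    rw [List.foldl_cons]
    rcases Cs with _ | ⟨C', Cs⟩
    · rw [List.foldl_nil, h_step, matchable_singleton]
    · rw [List.dropLast_cons_of_ne_nil (by simp), List.forall_mem_cons] at hCs
      rw [ih hCs.2 _ (pairwise_disjoint_matchStep hx C), h_step,
        matchable_cons_iff_matchStep hx hCs.1, and_assoc]

theorem matchable_map_singleton {U : List α} :
    Matchable (U.map fun u => [u]) Cs ↔
      ∃ R : List α, (R : Multiset α) ≤ U ∧ List.Forall₂ (· ∈ ·) R Cs := by
  have h_inj : Function.Injective fun u : α => [u] := fun _ _ => List.singleton_inj.1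
  have h_le (R : List α) : ((R.map fun u => [u] : List (List α)) : Multiset (List α)) ≤
      (U.map fun u => [u] : List (List α)) ↔ (R : Multiset α) ≤ U := by
    rw [← Multiset.map_coe, ← Multiset.map_coe, Multiset.map_le_map_iff h_inj]
  have h_meets (R : List α) : List.Forall₂ (fun B C => meets C B = true) (R.map fun u => [u]) Cs ↔
      List.Forall₂ (· ∈ ·) R Cs := by
    simp [List.forall₂_map_left_iff, meets]
  constructor
  · rintro ⟨Bs, hBs, h⟩
    obtain ⟨R, rfl⟩ : Bs ∈ Set.range (List.map fun u : α => [u]) := by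
      rw [Set.range_list_map]
      intro B hB
      obtain ⟨u, -, rfl⟩ := List.mem_map.1 (Multiset.mem_of_le hBs hB)
      exact ⟨u, rfl⟩
    exact ⟨R, (h_le R).1 hBs, (h_meets R).1 h⟩
  · rintro ⟨R, hR, h⟩
    exact ⟨R.map fun u => [u], (h_le R).2 hR, (h_meets R).2 h⟩

theorem hasRepresentatives_iff {U : List α} (hU : U.Nodup)
    (hCs : ∀ C ∈ Cs.dropLast, C.length ≤ 2) :
    hasRepresentatives U Cs = true ↔
      ∃ R : List α, R.Nodup ∧ R ⊆ U ∧ List.Forall₂ (· ∈ ·) R Cs := by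
  have h_disjoint : (U.map fun u => [u]).Pairwise List.Disjoint :=
    List.pairwise_map.2 (hU.imp fun h => by simpa using Ne.symm h)
  rw [hasRepresentatives, foldl_matchStep hCs _ h_disjoint]
  simp only [true_and, matchable_map_singleton]
  refine exists_congr fun R => ?_
  rw [← and_assoc]
  refine and_congr_left fun _ => ⟨fun h => ?_, fun h => (h.1.subperm h.2 :)⟩
  exact ⟨Multiset.nodup_of_le h hU, Multiset.subset_of_le h⟩

end Matching

/-! ### Correctness of the decision procedure -/

/-- The differences between adjacent cells. -/
def directions : List (ℤ × ℤ) := [(1, 0), (-1, 0), (0, 1), (0, -1), (1, -1), (-1, 1)]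

theorem adj_iff_sub_mem {c c' : Cell} : hexGrid.Adj c c' ↔ c' - c ∈ directions := by
  simp [hexGrid, directions, Prod.ext_iff]

theorem length_filter_directions_le : ∀ e ∈ directions, ∀ f ∈ directions, e - f ≠ 0 →
    (directions.filter fun d => decide (d - (e - f) ∈ directions)).length ≤ 2 := by
  decide

theorem length_common_neighbors_le {a b : Cell} (hab : a ≠ b) {l : List Cell} (hl : l.Nodup)
    (h : ∀ u ∈ l, hexGrid.Adj a u ∧ hexGrid.Adj b u) : l.length ≤ 2 := by
  simp only [adj_iff_sub_mem] at h
  obtain rfl | hne := eq_or_ne l []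
  · simp
  obtain ⟨u, hu⟩ := List.exists_mem_of_ne_nil l hne
  have h_diff : u - a - (u - b) = b - a := by abel
  have h_le := length_filter_directions_le _ (h u hu).1 _ (h u hu).2 (by
    rw [h_diff]; exact sub_ne_zero.2 hab.symm)
  rw [h_diff] at h_le
  have h_nodup : (l.map fun v => v - a).Nodup := hl.map fun _ _ h => sub_left_injective h
  have h_subset : (l.map fun v => v - a) ⊆
      directions.filter fun d => decide (d - (b - a) ∈ directions) := by
    intro d hd
    obtain ⟨v, hv, rfl⟩ := List.mem_map.1 hd
    refine List.mem_filter.2 ⟨(h v hv).1, decide_eq_true ?_⟩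
    rw [show v - a - (b - a) = v - b by abel]
    exact (h v hv).2
  simpa using (h_nodup.subperm h_subset).length_le.trans h_le

theorem abs_sub_eq_one {a b : ℕ} : |(a : ℤ) - (b : ℤ)| = 1 ↔ a = b + 1 ∨ b = a + 1 := by
  rw [abs_eq (by norm_num)]
  omega

theorem nodup_map_odd (n : ℕ) : ((List.range n).map fun i => 2 * i + 1).Nodup :=
  List.nodup_range.map fun i j (h : 2 * i + 1 = 2 * j + 1) => by omega

theorem lookup_eq_some_iff_mem {α β : Type} [BEq α] [LawfulBEq α] {l : List (α × β)}
    (h : (l.map Prod.fst).Nodup) {a : α} {b : β} : l.lookup a = some b ↔ (a, b) ∈ l := by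
  induction l with
  | nil => simp
  | cons e l ih =>
    obtain ⟨c, d⟩ := e
    rw [List.map_cons, List.nodup_cons] at h
    by_cases hac : a = c
    · subst hac
      have : (a, b) ∉ l := fun hb => h.1 (List.mem_map.2 ⟨_, hb, rfl⟩)
      simp [this, eq_comm]
    · simp [hac, ih h.2, List.lookup_cons, beq_false_of_ne hac]

namespace Data

variable {x : Data} {i : ℕ} {c : Cell}

/-- The requirements on the lists of a 1-over-2 game, apart from connectedness, which every
solution implies. The last index of `odd_placed` and the count in `length_free` together say that
the placed numbers are the odd ones up to the number of cells. -/
structure WellFormed (x : Data) : Prop where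
  ne_nil : x.cells ≠ []
  nodup_cells : x.cells.Nodup
  nodup_links : x.links.Nodup
  nodup_placed : x.placedCells.Nodup
  placed_mem : ∀ c ∈ x.placedCells, c ∈ x.cells
  odd_placed : ∀ i < x.placed.length, ∃ c, (c, 2 * i + 1) ∈ x.placed
  length_free : x.freeCells.length = x.placed.length ∨ x.freeCells.length + 1 = x.placed.length
  link_adj : ∀ e ∈ x.links, e.1 ∈ x.cells ∧ e.2 ∈ x.cells ∧ hexGrid.Adj e.1 e.2

theorem isWellFormed_iff : x.isWellFormed = true ↔ x.WellFormed := by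
  have h_odd : ∀ v, (∃ e ∈ x.placed, e.2 = v) ↔ ∃ c, (c, v) ∈ x.placed := fun v =>
    ⟨fun ⟨e, he, hv⟩ => ⟨e.1, hv ▸ he⟩, fun ⟨c, hc⟩ => ⟨_, hc, rfl⟩⟩
  simp only [isWellFormed, Bool.and_eq_true, Bool.or_eq_true, Bool.not_eq_true',
    decide_eq_true_eq, List.all_eq_true, List.any_eq_true, List.mem_range,
    List.isEmpty_eq_false_iff, isAdj_iff, h_odd]
  exact ⟨fun ⟨h₁, h₂, h₃, h₄, h₅, h₆, h₇, h₈⟩ => ⟨h₁, h₂, h₃, h₄, h₅, h₆, h₇, h₈⟩,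
    fun ⟨h₁, h₂, h₃, h₄, h₅, h₆, h₇, h₈⟩ => ⟨h₁, h₂, h₃, h₄, h₅, h₆, h₇, h₈⟩⟩

theorem mem_freeCells : c ∈ x.freeCells ↔ c ∈ x.cells ∧ c ∉ x.placedCells := by
  simp [freeCells]

theorem mem_placedCells : c ∈ x.placedCells ↔ ∃ v, (c, v) ∈ x.placed := by
  simp [placedCells]

theorem mem_slot :
    c ∈ x.slot i ↔ ∃ v, (c, v) ∈ x.placed ∧ (v = 2 * i + 1 ∨ v = 2 * i + 3) := by
  simp [slot, mul_add]

theorem mem_candidates {u : Cell} : u ∈ x.candidates i ↔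
    u ∈ x.freeCells ∧ (∀ c ∈ x.slot i, hexGrid.Adj c u) ∧
      ∀ e ∈ x.links, (e.1 = u → e.2 ∈ x.slot i) ∧ (e.2 = u → e.1 ∈ x.slot i) := by
  simp only [candidates, List.mem_filter, Bool.and_eq_true, List.all_eq_true, isAdj_iff,
    Bool.or_eq_true, Bool.not_eq_true', decide_eq_true_eq, decide_eq_false_iff_not,
    ← imp_iff_not_or]

theorem length_cells (hc : x.cells.Nodup) (hp : x.placedCells.Nodup)
    (hm : ∀ c ∈ x.placedCells, c ∈ x.cells) :
    x.cells.length = x.freeCells.length + x.placed.length := by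
  have h_perm : (x.cells.filter fun c => decide (c ∈ x.placedCells)).Perm x.placedCells := by
    refine (List.perm_ext_iff_of_nodup (hc.filter _) hp).2 fun c => ?_
    simpa using hm c
  have h_placed : x.placedCells.length = x.placed.length := List.length_map ..
  rw [List.length_eq_length_filter_add fun c => decide (c ∈ x.placedCells), h_perm.length_eq,
    h_placed, add_comm]
  rfl

/-- `s` is a solution of the game described by the lists. -/
structure IsSolution (x : Data) (s : Cell → ℕ) : Prop where
  bij : Set.BijOn s {c | c ∈ x.cells} (Set.Icc 1 x.cells.length)
  path : ∀ c ∈ x.cells, ∀ c' ∈ x.cells, |(s c : ℤ) - (s c' : ℤ)| = 1 → hexGrid.Adj c c'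
  placed : ∀ c v, (c, v) ∈ x.placed → s c = v
  given : ∀ c c', (c, c') ∈ x.links → |(s c : ℤ) - (s c' : ℤ)| = 1

namespace WellFormed

theorem length_eq (h : x.WellFormed) : x.cells.length = x.freeCells.length + x.placed.length :=
  length_cells h.nodup_cells h.nodup_placed h.placed_mem

theorem odd_perm_values (h : x.WellFormed) :
    ((List.range x.placed.length).map fun i => 2 * i + 1).Perm (x.placed.map Prod.snd) := by
  refine ((nodup_map_odd _).subperm fun v hv => ?_).perm_of_length_le (by simp)
  obtain ⟨i, hi, rfl⟩ := List.mem_map.1 hv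
  obtain ⟨c, hc⟩ := h.odd_placed i (List.mem_range.1 hi)
  exact List.mem_map.2 ⟨_, hc, rfl⟩

theorem value_odd (h : x.WellFormed) {v : ℕ} (hv : (c, v) ∈ x.placed) :
    ∃ i < x.placed.length, v = 2 * i + 1 := by
  obtain ⟨i, hi, hv⟩ := List.mem_map.1 (h.odd_perm_values.mem_iff.2 (List.mem_map.2 ⟨_, hv, rfl⟩))
  exact ⟨i, List.mem_range.1 hi, hv.symm⟩

theorem cell_unique (h : x.WellFormed) {c' : Cell} {v : ℕ} (hv : (c, v) ∈ x.placed)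
    (hv' : (c', v) ∈ x.placed) : c = c' :=
  congrArg Prod.fst (List.inj_on_of_nodup_map (h.odd_perm_values.nodup_iff.1 (nodup_map_odd _))
    hv hv' rfl)

theorem value_unique (h : x.WellFormed) {v v' : ℕ} (hv : (c, v) ∈ x.placed)
    (hv' : (c, v') ∈ x.placed) : v = v' :=
  congrArg Prod.snd (List.inj_on_of_nodup_map h.nodup_placed hv hv' rfl)

theorem length_candidates_le (h : x.WellFormed) (hi : i + 1 < x.freeCells.length) :
    (x.candidates i).length ≤ 2 := by
  have h_free := h.length_free
  obtain ⟨a, ha⟩ := h.odd_placed i (by omega)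
  obtain ⟨b, hb⟩ := h.odd_placed (i + 1) (by omega)
  have hab : a ≠ b := by
    rintro rfl
    have := h.value_unique ha hb
    omega
  refine length_common_neighbors_le hab ((h.nodup_cells.filter _).filter _) fun u hu => ?_
  have h_slot := (mem_candidates.1 hu).2.1
  exact ⟨h_slot a (mem_slot.2 ⟨_, ha, .inl rfl⟩), h_slot b (mem_slot.2 ⟨_, hb, .inr rfl⟩)⟩

end WellFormed

namespace IsSolution

variable {s : Cell → ℕ}

theorem odd_of_mem_placedCells (hs : x.IsSolution s) (h : x.WellFormed)
    (hc : c ∈ x.placedCells) : ∃ j, s c = 2 * j + 1 := by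
  obtain ⟨v, hv⟩ := mem_placedCells.1 hc
  obtain ⟨j, -, rfl⟩ := h.value_odd hv
  exact ⟨j, hs.placed _ _ hv⟩

theorem mem_placed_of_odd (hs : x.IsSolution s) (h : x.WellFormed) (hc : c ∈ x.cells)
    (hi : s c = 2 * i + 1) : (c, 2 * i + 1) ∈ x.placed := by
  have h_length := h.length_eq
  have h_free := h.length_free
  have h_le : s c ≤ x.cells.length := (hs.bij.mapsTo hc).2
  obtain ⟨c', hc'⟩ := h.odd_placed i (by omega)
  have : c = c' := hs.bij.injOn hc (h.placed_mem c' (mem_placedCells.2 ⟨_, hc'⟩))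
    (by rw [hi, hs.placed _ _ hc'])
  rwa [this]

theorem not_mem_placedCells_of_link (hs : x.IsSolution s) (h : x.WellFormed)
    {e : Cell × Cell} (he : e ∈ x.links) : ¬(e.1 ∈ x.placedCells ∧ e.2 ∈ x.placedCells) := by
  rintro ⟨h₁, h₂⟩
  obtain ⟨i, hi⟩ := hs.odd_of_mem_placedCells h h₁
  obtain ⟨j, hj⟩ := hs.odd_of_mem_placedCells h h₂
  have := abs_sub_eq_one.1 (hs.given e.1 e.2 he)
  omega

theorem mem_candidates_of_even (hs : x.IsSolution s) (h : x.WellFormed) (hc : c ∈ x.cells)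
    (hi : s c = 2 * i + 2) : c ∈ x.candidates i := by
  have h_free : c ∈ x.freeCells := mem_freeCells.2 ⟨hc, fun hp => by
    obtain ⟨j, hj⟩ := hs.odd_of_mem_placedCells h hp
    omega⟩
  have h_slot : ∀ c' ∈ x.cells, |(s c : ℤ) - (s c' : ℤ)| = 1 → c' ∈ x.slot i := by
    intro c' hc' hd
    rcases abs_sub_eq_one.1 hd with hd | hd
    · exact mem_slot.2 ⟨_, hs.mem_placed_of_odd (i := i) h hc' (by omega), .inl rfl⟩
    · exact mem_slot.2 ⟨_, hs.mem_placed_of_odd (i := i + 1) h hc' (by omega), .inr (by ring)⟩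
  refine mem_candidates.2 ⟨h_free, fun c' hc' => ?_, fun e he => ⟨?_, ?_⟩⟩
  · obtain ⟨v, hv, hvi⟩ := mem_slot.1 hc'
    refine hs.path c' (h.placed_mem c' (mem_placedCells.2 ⟨_, hv⟩)) _ hc (abs_sub_eq_one.2 ?_)
    rw [hs.placed c' v hv, hi]
    omega
  · rintro rfl
    exact h_slot _ (h.link_adj e he).2.1 (hs.given e.1 e.2 he)
  · rintro rfl
    exact h_slot _ (h.link_adj e he).1 (abs_sub_comm (s e.1 : ℤ) _ ▸ hs.given e.1 e.2 he)

end IsSolution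

/-- `R` is a choice of distinct free cells for the even numbers, its entry at index `i` being a
candidate for `2 * i + 2`. -/
structure IsFilling (x : Data) (R : List Cell) : Prop where
  nodup : R.Nodup
  subset : R ⊆ x.freeCells
  forall₂ : List.Forall₂ (· ∈ ·) R ((List.range x.freeCells.length).map x.candidates)

theorem IsSolution.exists_isFilling {s : Cell → ℕ} (hs : x.IsSolution s) (h : x.WellFormed) :
    ∃ R, x.IsFilling R := by
  have h_length := h.length_eq
  have h_free := h.length_free
  have h_even : ∀ i ∈ List.range x.freeCells.length, ∃ c ∈ x.cells, s c = 2 * i + 2 := by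
    intro i hi
    have := List.mem_range.1 hi
    exact hs.bij.surjOn (show 2 * i + 2 ∈ Set.Icc 1 x.cells.length from ⟨by omega, by omega⟩)
  choose! g hg hsg using h_even
  have h_cand : ∀ i ∈ List.range x.freeCells.length, g i ∈ x.candidates i := fun i hi =>
    hs.mem_candidates_of_even h (hg i hi) (hsg i hi)
  refine ⟨(List.range x.freeCells.length).map g, ?_, ?_, ?_⟩
  · refine List.nodup_range.map_on fun i hi j hj hij => ?_
    have := hsg i hi
    rw [hij, hsg j hj] at this
    omega
  · intro c hc
    obtain ⟨i, hi, rfl⟩ := List.mem_map.1 hc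
    exact (mem_candidates.1 (h_cand i hi)).1
  · rwa [List.forall₂_map_left_iff, List.forall₂_map_right_iff, List.forall₂_same]

/-- The numbering of the cells that extends the placed numbers by `2 * i + 2` on the entry of `R`
at index `i`. -/
def numbering (x : Data) (R : List Cell) (c : Cell) : ℕ :=
  (x.placed.lookup c).getD (2 * R.idxOf c + 2)

theorem WellFormed.numbering_placed (h : x.WellFormed) {R : List Cell} {v : ℕ}
    (hv : (c, v) ∈ x.placed) : x.numbering R c = v := by
  rw [numbering, (lookup_eq_some_iff_mem h.nodup_placed).2 hv, Option.getD_some]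

namespace IsFilling

variable {R : List Cell}

theorem length_eq (hR : x.IsFilling R) : R.length = x.freeCells.length := by
  simpa using hR.forall₂.length_eq

theorem exists_getElem_eq (hR : x.IsFilling R) (hc : c ∈ x.freeCells) :
    ∃ i, ∃ hi : i < R.length, R[i] = c :=
  have h_perm := (hR.nodup.subperm hR.subset).perm_of_length_le hR.length_eq.ge
  List.mem_iff_getElem.1 (h_perm.mem_iff.2 hc)

theorem getElem_mem_candidates (hR : x.IsFilling R) (hi : i < R.length) :
    R[i] ∈ x.candidates i := by
  simpa using hR.forall₂.get hi (by simpa [← hR.length_eq] using hi)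

theorem numbering_getElem (hR : x.IsFilling R) (hi : i < R.length) :
    x.numbering R R[i] = 2 * i + 2 := by
  have h_not : R[i] ∉ x.placedCells := (mem_freeCells.1 (hR.subset (List.getElem_mem hi))).2
  have h_none : x.placed.lookup R[i] = none := List.lookup_eq_none_iff.2 fun e he => by
    rw [bne_iff_ne]
    exact fun hce => h_not (hce ▸ List.mem_map.2 ⟨e, he, rfl⟩)
  rw [numbering, h_none, Option.getD_none, hR.nodup.idxOf_getElem]

theorem numbering_cases (hR : x.IsFilling R) (h : x.WellFormed) (hc : c ∈ x.cells) :
    (∃ i < x.placed.length, (c, 2 * i + 1) ∈ x.placed ∧ x.numbering R c = 2 * i + 1) ∨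
      ∃ i, ∃ hi : i < R.length, R[i] = c ∧ x.numbering R c = 2 * i + 2 := by
  by_cases hp : c ∈ x.placedCells
  · obtain ⟨v, hv⟩ := mem_placedCells.1 hp
    obtain ⟨i, hi, rfl⟩ := h.value_odd hv
    exact .inl ⟨i, hi, hv, h.numbering_placed hv⟩
  · obtain ⟨i, hi, rfl⟩ := hR.exists_getElem_eq (mem_freeCells.2 ⟨hc, hp⟩)
    exact .inr ⟨i, hi, rfl, hR.numbering_getElem hi⟩

theorem adj_getElem (hR : x.IsFilling R) (h : x.WellFormed) (hi : i < R.length)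
    (hc : c ∈ x.cells) (hv : x.numbering R c = 2 * i + 1 ∨ x.numbering R c = 2 * i + 3) :
    hexGrid.Adj c R[i] := by
  rcases hR.numbering_cases h hc with ⟨j, -, hj, hcj⟩ | ⟨j, -, -, hcj⟩
  · exact (mem_candidates.1 (hR.getElem_mem_candidates hi)).2.1 c (mem_slot.2 ⟨_, hj, by omega⟩)
  · omega

theorem abs_numbering_getElem_sub (hR : x.IsFilling R) (h : x.WellFormed) (hi : i < R.length)
    (hc : c ∈ x.slot i) : |(x.numbering R R[i] : ℤ) - (x.numbering R c : ℤ)| = 1 := by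
  obtain ⟨v, hv, hvi⟩ := mem_slot.1 hc
  rw [abs_sub_eq_one, hR.numbering_getElem hi, h.numbering_placed hv]
  omega

theorem bijOn_numbering (hR : x.IsFilling R) (h : x.WellFormed) :
    Set.BijOn (x.numbering R) {c | c ∈ x.cells} (Set.Icc 1 x.cells.length) := by
  have h_length := h.length_eq
  have h_free := h.length_free
  have h_R := hR.length_eq
  refine ⟨fun c hc => ?_, fun c hc c' hc' h_eq => ?_, fun v hv => ?_⟩
  · rcases hR.numbering_cases h hc with ⟨i, hi, -, hci⟩ | ⟨i, hi, -, hci⟩ <;>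
    · rw [Set.mem_Icc, hci]; omega
  · rcases hR.numbering_cases h hc with ⟨i, -, hi, hci⟩ | ⟨i, hi, rfl, hci⟩ <;>
      rcases hR.numbering_cases h hc' with ⟨j, -, hj, hcj⟩ | ⟨j, hj, rfl, hcj⟩
    · obtain rfl : i = j := by omega
      exact h.cell_unique hi hj
    · omega
    · omega
    · obtain rfl : i = j := by omega
      rfl
  · rw [Set.mem_Icc] at hv
    rcases Nat.even_or_odd' (v - 1) with ⟨i, hi | hi⟩
    · obtain rfl : v = 2 * i + 1 := by omega
      obtain ⟨c, hc⟩ := h.odd_placed i (by omega)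
      exact ⟨c, h.placed_mem c (mem_placedCells.2 ⟨_, hc⟩), h.numbering_placed hc⟩
    · obtain rfl : v = 2 * i + 2 := by omega
      have hiR : i < R.length := by omega
      exact ⟨R[i], (mem_freeCells.1 (hR.subset (List.getElem_mem hiR))).1,
        hR.numbering_getElem hiR⟩

theorem isSolution_numbering (hR : x.IsFilling R) (h : x.WellFormed)
    (h_link : ∀ e ∈ x.links, ¬(e.1 ∈ x.placedCells ∧ e.2 ∈ x.placedCells)) :
    x.IsSolution (x.numbering R) where
  bij := hR.bijOn_numbering h
  path c hc c' hc' hd := by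
    rw [abs_sub_eq_one] at hd
    rcases hR.numbering_cases h hc with ⟨i, -, -, hci⟩ | ⟨i, hi, rfl, hci⟩
    · rcases hR.numbering_cases h hc' with ⟨j, -, -, hcj⟩ | ⟨j, hj, rfl, hcj⟩
      · omega
      · exact hR.adj_getElem h hj hc (by omega)
    · exact (hR.adj_getElem h hi hc' (by omega)).symm
  placed _ _ hv := h.numbering_placed hv
  given c c' he := by
    obtain ⟨hc, hc', -⟩ := h.link_adj _ he
    by_cases hp : c ∈ x.placedCells
    · have hp' : c' ∉ x.placedCells := fun hp' => h_link _ he ⟨hp, hp'⟩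
      obtain ⟨i, hi, rfl⟩ := hR.exists_getElem_eq (mem_freeCells.2 ⟨hc', hp'⟩)
      rw [abs_sub_comm]
      exact hR.abs_numbering_getElem_sub h hi
        (((mem_candidates.1 (hR.getElem_mem_candidates hi)).2.2 _ he).2 rfl)
    · obtain ⟨i, hi, rfl⟩ := hR.exists_getElem_eq (mem_freeCells.2 ⟨hc, hp⟩)
      exact hR.abs_numbering_getElem_sub h hi
        (((mem_candidates.1 (hR.getElem_mem_candidates hi)).2.2 _ he).1 rfl)

end IsFilling

namespace WellFormed

theorem hasRepresentatives_iff (h : x.WellFormed) :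
    hasRepresentatives x.freeCells ((List.range x.freeCells.length).map x.candidates) = true ↔
      ∃ R, x.IsFilling R := by
  have h_small : ∀ C ∈ ((List.range x.freeCells.length).map x.candidates).dropLast,
      C.length ≤ 2 := by
    intro C hC
    obtain ⟨i, hi, rfl⟩ := List.mem_iff_getElem.1 hC
    rw [List.length_dropLast, List.length_map, List.length_range] at hi
    rw [List.getElem_dropLast, List.getElem_map, List.getElem_range]
    exact h.length_candidates_le (by omega)
  rw [Rikudo.hasRepresentatives_iff (U := x.freeCells) (h.nodup_cells.filter _) h_small]
  exact ⟨fun ⟨R, h₁, h₂, h₃⟩ => ⟨R, h₁, h₂, h₃⟩, fun ⟨R, hR⟩ => ⟨R, hR.1, hR.2, hR.3⟩⟩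

theorem isSolvable_iff (h : x.WellFormed) : x.isSolvable = true ↔ ∃ s, x.IsSolution s := by
  rw [isSolvable, Bool.and_eq_true, Bool.and_eq_true, isWellFormed_iff, h.hasRepresentatives_iff]
  simp only [h, true_and, List.all_eq_true, Bool.not_eq_true', Bool.and_eq_false_iff,
    decide_eq_false_iff_not, ← not_and_or]
  exact ⟨fun ⟨h_link, R, hR⟩ => ⟨_, hR.isSolution_numbering h h_link⟩,
    fun ⟨s, hs⟩ => ⟨fun e he => hs.not_mem_placedCells_of_link h he, hs.exists_isFilling h⟩⟩

end WellFormed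

/-- The lists of `x` are those of the game `G`. -/
structure Describes (x : Data) (G : Game) : Prop where
  nodup_cells : x.cells.Nodup
  nodup_placed : x.placed.Nodup
  nodup_links : x.links.Nodup
  mem_cells : ∀ c, c ∈ x.cells ↔ c ∈ G.τ
  mem_placed : ∀ c v, (c, v) ∈ x.placed ↔ G.m c = some v
  mem_links : ∀ e, e ∈ x.links ↔ e ∈ G.p

namespace Describes

variable {G : Game}

theorem length_eq (h : x.Describes G) : x.cells.length = G.n := by
  have h_toFinset : G.τ = x.cells.toFinset := by
    ext c
    rw [List.mem_toFinset, h.mem_cells]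
  rw [Game.n, h_toFinset, List.toFinset_card_of_nodup h.nodup_cells]

theorem isSolution_iff (h : x.Describes G) (s : Cell → ℕ) : G.IsSolution s ↔ x.IsSolution s := by
  have h_cells : (G.τ : Set Cell) = {c | c ∈ x.cells} := Set.ext fun c => (h.mem_cells c).symm
  constructor
  · rintro ⟨h₁, h₂, h₃, h₄⟩
    refine ⟨by rwa [← h_cells, h.length_eq], ?_, ?_, ?_⟩ <;>
      simpa only [h.mem_cells, h.mem_placed, h.mem_links]
  · rintro ⟨h₁, h₂, h₃, h₄⟩
    refine ⟨by rwa [h_cells, ← h.length_eq], ?_, ?_, ?_⟩ <;>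
      simpa only [← h.mem_cells, ← h.mem_placed, ← h.mem_links]

theorem exists_placed_iff (h : x.Describes G) (hG : G.IsOneOver 2) {v : ℕ} :
    (∃ c, (c, v) ∈ x.placed) ↔ (∃ i, v = 2 * i + 1) ∧ v ≤ x.cells.length := by
  have h_iff := Set.ext_iff.1 hG v
  simp only [Set.mem_ofPred_eq, Set.mem_inter_iff, Set.mem_Icc, ← h.mem_placed,
    ← h.length_eq, mul_comm _ 2] at h_iff
  rw [h_iff]
  exact ⟨fun ⟨hi, _, hv⟩ => ⟨hi, hv⟩, fun ⟨⟨i, hi⟩, hv⟩ => ⟨⟨i, hi⟩, by omega, hv⟩⟩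

theorem nodup_placedCells (h : x.Describes G) : x.placedCells.Nodup := by
  refine h.nodup_placed.map_on fun e he e' he' hc => Prod.ext hc (Option.some.inj ?_)
  rw [← (h.mem_placed _ _).1 he, ← (h.mem_placed _ _).1 he', hc]

theorem nodup_values (h : x.Describes G) : (x.placed.map Prod.snd).Nodup :=
  h.nodup_placed.map_on fun _ he _ he' hv =>
    Prod.ext (G.m_inj _ _ _ ((h.mem_placed _ _).1 he) (hv ▸ (h.mem_placed _ _).1 he')) hv

theorem length_placed (h : x.Describes G) (hG : G.IsOneOver 2) :
    x.placed.length = (x.cells.length + 1) / 2 := by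
  have h_perm : (x.placed.map Prod.snd).Perm
      ((List.range ((x.cells.length + 1) / 2)).map fun i => 2 * i + 1) := by
    refine (List.perm_ext_iff_of_nodup h.nodup_values (nodup_map_odd _)).2 fun v => ?_
    have h_values : v ∈ x.placed.map Prod.snd ↔ ∃ c, (c, v) ∈ x.placed := by simp
    rw [h_values, h.exists_placed_iff hG, List.mem_map]
    constructor
    · rintro ⟨⟨i, rfl⟩, hi⟩
      exact ⟨i, List.mem_range.2 (by omega), rfl⟩
    · rintro ⟨i, hi, rfl⟩
      have := List.mem_range.1 hi
      exact ⟨⟨i, rfl⟩, by omega⟩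
  simpa using h_perm.length_eq

theorem placed_mem (h : x.Describes G) (hc : c ∈ x.placedCells) : c ∈ x.cells := by
  obtain ⟨v, hv⟩ := mem_placedCells.1 hc
  exact (h.mem_cells c).2 (G.m_dom c v ((h.mem_placed c v).1 hv))

theorem wellFormed (h : x.Describes G) (hG : G.IsOneOver 2) : x.WellFormed where
  ne_nil h_nil := by
    obtain ⟨c, hc⟩ := G.connected.nonempty
    have := (h.mem_cells c).2 hc
    simp [h_nil] at this
  nodup_cells := h.nodup_cells
  nodup_links := h.nodup_links
  nodup_placed := h.nodup_placedCells
  placed_mem _ := h.placed_mem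
  odd_placed i hi := by
    have := h.length_placed hG
    exact (h.exists_placed_iff hG).2 ⟨⟨i, rfl⟩, by omega⟩
  length_free := by
    have := h.length_placed hG
    have := length_cells h.nodup_cells h.nodup_placedCells fun _ => h.placed_mem
    omega
  link_adj e he := by
    have := G.p_adj e.1 e.2 ((h.mem_links e).1 he)
    rwa [h.mem_cells, h.mem_cells]

end Describes

theorem IsSolution.connected {s : Cell → ℕ} (hs : x.IsSolution s) (hx : x.cells ≠ []) :
    (hexGrid.induce {c | c ∈ x.cells}).Connected := by
  obtain ⟨c₁, hc₁, hs₁⟩ := hs.bij.surjOn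
    (show 1 ∈ Set.Icc 1 x.cells.length from ⟨le_rfl, List.length_pos_iff.2 hx⟩)
  have h_reachable : ∀ v, ∀ c : {c | c ∈ x.cells}, s c = v + 1 →
      (hexGrid.induce {c | c ∈ x.cells}).Reachable ⟨c₁, hc₁⟩ c := by
    intro v
    induction v with
    | zero =>
      intro c hc
      obtain rfl : c₁ = c := hs.bij.injOn hc₁ c.2 (by rw [hs₁, hc])
      rfl
    | succ v ih =>
      intro c hc
      have h_le := (hs.bij.mapsTo c.2).2
      obtain ⟨c', hc', hs'⟩ := hs.bij.surjOn
        (show v + 1 ∈ Set.Icc 1 x.cells.length from ⟨by omega, by omega⟩)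
      refine (ih ⟨c', hc'⟩ hs').trans (SimpleGraph.Adj.reachable ?_)
      exact hs.path c' hc' c c.2 (abs_sub_eq_one.2 (by omega))
  refine (SimpleGraph.connected_iff_exists_forall_reachable _).2 ⟨⟨c₁, hc₁⟩, fun c => ?_⟩
  have h_pos := (hs.bij.mapsTo c.2).1
  exact h_reachable (s c - 1) c (by omega)

namespace WellFormed

/-- The game described by well-formed lists with a connected set of cells. -/
def game (h : x.WellFormed) (hc : (hexGrid.induce {c | c ∈ x.cells}).Connected) : Game where
  τ := x.cells.toFinset
  connected := by rwa [List.coe_toFinset]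
  m c := x.placed.lookup c
  m_dom c v hv := List.mem_toFinset.2 (h.placed_mem c
    (mem_placedCells.2 ⟨v, (lookup_eq_some_iff_mem h.nodup_placed).1 hv⟩))
  m_range c v hv := by
    have := h.length_eq
    have := h.length_free
    obtain ⟨i, hi, rfl⟩ := h.value_odd ((lookup_eq_some_iff_mem h.nodup_placed).1 hv)
    rw [List.toFinset_card_of_nodup h.nodup_cells]
    omega
  m_inj c c' v hv hv' := h.cell_unique ((lookup_eq_some_iff_mem h.nodup_placed).1 hv)
    ((lookup_eq_some_iff_mem h.nodup_placed).1 hv')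
  p := x.links.toFinset
  p_adj c c' he := by
    simpa only [List.mem_toFinset] using h.link_adj _ (List.mem_toFinset.1 he)

theorem describes_game (h : x.WellFormed) (hc : (hexGrid.induce {c | c ∈ x.cells}).Connected) :
    x.Describes (h.game hc) where
  nodup_cells := h.nodup_cells
  nodup_placed := h.nodup_placed.of_map _
  nodup_links := h.nodup_links
  mem_cells _ := List.mem_toFinset.symm
  mem_placed _ _ := (lookup_eq_some_iff_mem h.nodup_placed).symm
  mem_links _ := List.mem_toFinset.symm

theorem isOneOver_game (h : x.WellFormed) (hc : (hexGrid.induce {c | c ∈ x.cells}).Connected) :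
    (h.game hc).IsOneOver 2 := by
  have h_length := h.length_eq
  have h_free := h.length_free
  ext v
  simp only [Set.mem_ofPred_eq, Set.mem_inter_iff, Set.mem_Icc, ← (h.describes_game hc).mem_placed,
    ← (h.describes_game hc).length_eq, mul_comm _ 2]
  constructor
  · rintro ⟨c, hv⟩
    obtain ⟨i, hi, rfl⟩ := h.value_odd hv
    exact ⟨⟨i, rfl⟩, by omega, by omega⟩
  · rintro ⟨⟨i, rfl⟩, -, hv⟩
    exact h.odd_placed i (by omega)

end WellFormed

theorem isSolvable_iff :
    x.isSolvable = true ↔ ∃ G : Game, x.Describes G ∧ G.IsOneOver 2 ∧ G.Solvable := by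
  constructor
  · intro hx
    have h : x.WellFormed := isWellFormed_iff.1 (Bool.and_eq_true_iff.1 hx).1
    obtain ⟨s, hs⟩ := h.isSolvable_iff.1 hx
    have hc := hs.connected h.ne_nil
    exact ⟨_, h.describes_game hc, h.isOneOver_game hc, s,
      ((h.describes_game hc).isSolution_iff s).2 hs⟩
  · rintro ⟨G, hG, hG₂, s, hs⟩
    exact (hG.wellFormed hG₂).isSolvable_iff.2 ⟨s, (hG.isSolution_iff s).1 hs⟩

end Data

theorem decideWord_iff (w : List Γ') : decideWord w = true ↔ w ∈ oneOverRikudo 2 := by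
  change _ ↔ ∃ G : Game, Encodes w G ∧ G.IsOneOver 2 ∧ G.Solvable
  rw [decideWord, Bool.and_eq_true, decide_eq_true_eq, Data.isSolvable_iff]
  constructor
  · rintro ⟨hw, G, ⟨h₁, h₂, h₃, h₄, h₅, h₆⟩, hG⟩
    exact ⟨G, ⟨_, _, _, h₁, h₂, h₃, h₄, h₅, h₆, hw.symm⟩, hG⟩
  · rintro ⟨G, ⟨cells, placed, links, h₁, h₂, h₃, h₄, h₅, h₆, rfl⟩, hG⟩
    rw [parse_encLists (cells, placed, links)]
    exact ⟨rfl, G, ⟨h₁, h₂, h₃, h₄, h₅, h₆⟩, hG⟩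

end Rikudo

theorem theorem3 : Rikudo.InP (Rikudo.oneOverRikudo 2) :=
  Rikudo.PolyTime.decideWord.inP Rikudo.decideWord_iff
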